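/- Let $M$ be a Hausdorff real-analytic $d$-manifold (the spatial slice; $d=3$ in the application) and $G$ a second countable compact Hausdorff group (for instance $\mathrm{SU}(2)$ or $\mathrm{U}(1)^3$). A graph $\gamma$ is a finite set of oriented embedded piecewise analytic arcs in $M$ that meet at most in common end points; graphs are regarded as equal, and one is regarded as contained in another, when this holds for the underlying point sets. $V(\gamma)$ is the set of end points of the edges of $\gamma$. Let $\mathcal H=L^2(\overline{\mathcal A},\mu_{\rm AL})$, with $\overline{\mathcal A}$ the space of generalized $G$-connections on $M$ and $\mu_{\rm AL}$ the Ashtekar–Lewandowski measure. Let $\mathcal H_\gamma\subseteq\mathcal H$ be the closure of the space of gauge-invariant continuous functions of the holonomies along the edges of $\gamma$, with orthogonal projector $P_\gamma$, and let $\mathcal H'_\gamma$ be the set of states in $\mathcal H_\gamma$ that are orthogonal to $\mathcal H_{\gamma'}$ for every graph $\gamma'$ properly contained in $\gamma$. Let $\mathrm{Diff}$ be the group of analytic diffeomorphisms of $M$, $U_\varphi$ its unitary action on $\mathcal H$, and $\mathrm{Diff}_\gamma$ the subgroup of those diffeomorphisms that map $\gamma$ onto itself. Let $|\Psi)=\sum_{\gamma\in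 S}|\eta(\Psi_\gamma))$ be a diffeomorphism-invariant state: $S$ is a set of graphs of which only finitely many are diffeomorphic to any given graph, $\Psi_\gamma\in\mathcal H'_\gamma$ is invariant under $\mathrm{Diff}_\gamma$, and $$(\Psi|f\rangle=\sum_{\gamma\in S}\ \sum_{[\varphi]\in \mathrm{Diff}/\mathrm{Diff}_\gamma}\langle U_\varphi\Psi_\gamma,f\rangle .$$ Let $N\mapsto\hat H(N)$, $N:M\to\mathbb R$, be a family of linear operators on a common domain $D\subseteq\mathcal H$ that is graph-preserving, i.e. $\hat H(N)(D\cap\mathcal H_\gamma)\subseteq\mathcal H_\gamma$ for all $\gamma$ and $N$. Put $\hat H_v=\hat H(\delta_v)$ with $\delta_v$ the Kronecker delta function at $v$. Fix a graph $\gamma_0$ such that $D\cap\mathcal H_{\gamma_0}$ is dense in $\mathcal H_{\gamma_0}$ and $\hat H(N)f=\sum_{v\in V(\gamma_0)}N(v)\,\hat H_vf$ for all $N$ and all $f\in D\cap\mathcal H_{\gamma_0}$. Let $$\hat{\mathcal Q}=\sum_{v\in V(\gamma_0)}\hat H_v|_{\mathcal H_{\gamma_0}}\big(\hat H_v|_{\mathcal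 H_{\gamma_0}}\big)^\dagger,\qquad \hat H_v|_{\mathcal H_{\gamma_0}}=P_{\gamma_0}\hat H_vP_{\gamma_0},$$ with its natural domain, and $$\widetilde\Psi=\sum_{\alpha\subseteq\gamma_0}\widetilde\Psi_\alpha,\qquad \widetilde\Psi_\alpha=\sum_{\gamma\in S,\ [\varphi]\in\mathrm{Diff}/\mathrm{Diff}_\gamma,\ \varphi(\gamma)=\alpha}U_\varphi\Psi_\gamma ,$$ where $\alpha$ runs over the subgraphs of $\gamma_0$ formed by subsets of its edges. Then for each $f\in\mathcal H_{\gamma_0}$ only finitely many terms of $(\Psi|f\rangle$ are non-zero, $\widetilde\Psi\in\mathcal H_{\gamma_0}$, and the following are equivalent: 1. $(\Psi|\hat H(N)f\rangle=0$ for all $N:M\to\mathbb R$ and all $f\in D\cap\mathcal H_{\gamma_0}$; 2. $\widetilde\Psi$ lies in the domain of $\hat{\mathcal Q}$ and $\langle\widetilde\Psi,\hat{\mathcal Q}\,\widetilde\Psi\rangle=0$. -/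

import Mathlib

open scoped Manifold ContDiff Pointwise InnerProductSpace
open MeasureTheory

namespace LQG

noncomputable section

/-! ### Edges, graphs and diffeomorphisms of a real-analytic manifold -/

section Geometry

variable (d : ℕ) (M : Type*) [TopologicalSpace M] [ChartedSpace (EuclideanSpace ℝ (Fin d)) M]

/-- The group of real-analytic diffeomorphisms of `M`. -/
def Diff : Subgroup (Equiv.Perm M) where
  carrier := {φ | ContMDiff (𝓡 d) (𝓡 d) ω φ ∧ ContMDiff (𝓡 d) (𝓡 d) ω φ.symm}
  one_mem' := ⟨contMDiff_id, contMDiff_id⟩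
  mul_mem' := fun hφ hψ => ⟨hφ.1.comp hψ.1, hψ.2.comp hφ.2⟩
  inv_mem' := fun hφ => ⟨hφ.2, hφ.1⟩

variable {M}

/-- `S` is the image of a compact interval `[a, b]` under a real-analytic embedding (injective,
with nowhere vanishing velocity, analytic up to the end points) that runs from `x` to `y`. -/
def IsAnalyticArc (S : Set M) (x y : M) : Prop :=
  ∃ (a b : ℝ) (c : ℝ → M), a < b ∧
    ContMDiffOn 𝓘(ℝ, ℝ) (𝓡 d) ω c (Set.Icc a b) ∧
    Set.InjOn c (Set.Icc a b) ∧
    (∀ t ∈ Set.Icc a b, mfderivWithin 𝓘(ℝ, ℝ) (𝓡 d) c (Set.Icc a b) t ≠ 0) ∧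
    c '' Set.Icc a b = S ∧ c a = x ∧ c b = y

/-- Embedded piecewise analytic arcs `S` from `x` to `y`: finite concatenations of analytic arcs. -/
inductive IsArc : Set M → M → M → Prop
  | analytic {S : Set M} {x y : M} : IsAnalyticArc d S x y → IsArc S x y
  | concat {S T : Set M} {x y z : M} :
      IsArc S x y → IsArc T y z → S ∩ T = {y} → IsArc (S ∪ T) x z

variable (M)

/-- An oriented edge in `M`. An embedded arc with its source and its target determines an oriented
path up to orientation-preserving reparametrization, so no quotient is needed. -/
@[ext] structure Edge where
  carrier : Set M
  source : M
  target : M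
  isArc : IsArc d carrier source target

/-- An oriented graph embedded in `M`: a finite set of oriented edges, any two of which meet at most
in common end points. -/
@[ext] structure Graph where
  edges : Finset (Edge d M)
  disj : ∀ e ∈ edges, ∀ e' ∈ edges, e ≠ e' →
    e.carrier ∩ e'.carrier ⊆ {e.source, e.target} ∩ {e'.source, e'.target}

variable {d M}

/-- The point set of a graph. -/
def Graph.support (γ : Graph d M) : Set M := ⋃ e ∈ γ.edges, e.carrier

open scoped Classical in
/-- The vertices of a graph. -/
def Graph.vertices (γ : Graph d M) : Finset M :=
  γ.edges.image Edge.source ∪ γ.edges.image Edge.target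

open scoped Classical in
/-- The subgraph of `γ` that consists of those edges of `γ` that lie in `F`. -/
def Graph.subgraph (γ : Graph d M) (F : Finset (Edge d M)) : Graph d M where
  edges := γ.edges ∩ F
  disj := fun e he e' he' => γ.disj e (Finset.mem_inter.1 he).1 e' (Finset.mem_inter.1 he').1

/-- The diffeomorphisms that map a graph onto itself. -/
def Graph.stab (γ : Graph d M) : Subgroup (Diff d M) := MulAction.stabilizer (Diff d M) γ.support

theorem IsAnalyticArc.map [IsManifold (𝓡 d) ω M] (φ : Diff d M) {S : Set M} {x y : M}
    (h : IsAnalyticArc d S x y) :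
    IsAnalyticArc d ((φ : Equiv.Perm M) '' S) ((φ : Equiv.Perm M) x) ((φ : Equiv.Perm M) y) := by
  obtain ⟨a, b, c, hab, hc, hinj, hder, rfl, rfl, rfl⟩ := h
  refine ⟨a, b, (φ : Equiv.Perm M) ∘ c, hab, φ.2.1.comp_contMDiffOn hc,
    (φ : Equiv.Perm M).injective.injOn.comp hinj (Set.mapsTo_univ _ _), ?_, Set.image_comp _ _ _,
    rfl, rfl⟩
  intro t ht h0
  have hu : UniqueMDiffWithinAt 𝓘(ℝ, ℝ) (Set.Icc a b) t :=
    (uniqueDiffOn_Icc hab t ht).uniqueMDiffWithinAt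
  have hct : MDifferentiableWithinAt 𝓘(ℝ, ℝ) (𝓡 d) c (Set.Icc a b) t :=
    (hc t ht).mdifferentiableWithinAt (by simp)
  have hφ : MDifferentiable (𝓡 d) (𝓡 d) (φ : Equiv.Perm M) := φ.2.1.mdifferentiable (by simp)
  have hφ' : MDifferentiable (𝓡 d) (𝓡 d) (φ : Equiv.Perm M).symm :=
    φ.2.2.mdifferentiable (by simp)
  have key : mfderivWithin 𝓘(ℝ, ℝ) (𝓡 d) ((φ : Equiv.Perm M).symm ∘ ((φ : Equiv.Perm M) ∘ c))
      (Set.Icc a b) t = 0 := by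
    rw [mfderiv_comp_mfderivWithin t (hφ' _) ((hφ _).comp_mdifferentiableWithinAt t hct) hu, h0]
    exact ContinuousLinearMap.comp_zero _
  have he : (φ : Equiv.Perm M).symm ∘ ((φ : Equiv.Perm M) ∘ c) = c := by
    funext u; simp
  rw [he] at key
  exact hder t ht key

theorem IsArc.map [IsManifold (𝓡 d) ω M] (φ : Diff d M) {S : Set M} {x y : M}
    (h : IsArc d S x y) :
    IsArc d ((φ : Equiv.Perm M) '' S) ((φ : Equiv.Perm M) x) ((φ : Equiv.Perm M) y) := by
  induction h with
  | analytic h => exact .analytic (h.map φ)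
  | concat h₁ h₂ hST ih₁ ih₂ =>
    rw [Set.image_union]
    refine .concat ih₁ ih₂ ?_
    rw [← Set.image_inter (φ : Equiv.Perm M).injective, hST, Set.image_singleton]

/-- The image of an oriented edge under a diffeomorphism. -/
def Edge.map [IsManifold (𝓡 d) ω M] (φ : Diff d M) (e : Edge d M) : Edge d M where
  carrier := (φ : Equiv.Perm M) '' e.carrier
  source := (φ : Equiv.Perm M) e.source
  target := (φ : Equiv.Perm M) e.target
  isArc := e.isArc.map φ

end Geometry

/-! ### Generalized connections and the kinematical Hilbert space -/

section Kinematics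

variable (d : ℕ) (M : Type*) [TopologicalSpace M] [ChartedSpace (EuclideanSpace ℝ (Fin d)) M]
variable (G : Type*) [Group G]

/-- Generalized connections: assignments of a holonomy in `G` to every oriented edge that respect
the reversal and the composition of edges (equivalently, homomorphisms from the groupoid of
paths in `M` to `G`). -/
@[ext] structure GenConn where
  val : Edge d M → G
  reverse : ∀ e e' : Edge d M, e'.carrier = e.carrier → e'.source = e.target →
    e'.target = e.source → val e' = (val e)⁻¹
  concat : ∀ e f k : Edge d M, e.target = f.source → e.carrier ∩ f.carrier = {e.target} →
    k.carrier = e.carrier ∪ f.carrier → k.source = e.source → k.target = f.target →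
    val k = val e * val f

variable {d M G}

/-- The action of a gauge transformation `g : M → G` on generalized connections. -/
def gauge (g : M → G) (A : GenConn d M G) : GenConn d M G where
  val e := g e.source * A.val e * (g e.target)⁻¹
  reverse e e' hc hs ht := by rw [A.reverse e e' hc hs ht, hs, ht]; group
  concat e f k hef hi hc hs ht := by rw [A.concat e f k hef hi hc hs ht, hs, ht, hef]; group

/-- The action of a diffeomorphism on generalized connections by pull-back. -/
def pullback [IsManifold (𝓡 d) ω M] (φ : Diff d M) (A : GenConn d M G) : GenConn d M G where
  val e := A.val (e.map φ)
  reverse e e' hc hs ht :=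
    A.reverse _ _ (by simp [Edge.map, hc]) (by simp [Edge.map, hs]) (by simp [Edge.map, ht])
  concat e f k hef hi hc hs ht :=
    A.concat _ _ _ (by simp [Edge.map, hef])
      (by
        simp only [Edge.map]
        rw [← Set.image_inter (φ : Equiv.Perm M).injective, hi, Set.image_singleton])
      (by simp only [Edge.map]; rw [hc, Set.image_union]) (by simp [Edge.map, hs])
      (by simp [Edge.map, ht])

/-- The holonomies along the edges of a finite family. -/
def hol (F : Finset (Edge d M)) (A : GenConn d M G) : F → G := fun e => A.val e

/-- The σ-algebra generated by the holonomies along edges. -/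
instance [MeasurableSpace G] : MeasurableSpace (GenConn d M G) :=
  MeasurableSpace.comap GenConn.val inferInstance

/-- The normalized Haar measure of a compact group. -/
def haarProb (G : Type*) [Group G] [TopologicalSpace G] [IsTopologicalGroup G] [CompactSpace G]
    [MeasurableSpace G] [BorelSpace G] : Measure G :=
  Measure.haarMeasure ⊤

variable [TopologicalSpace G] [IsTopologicalGroup G] [CompactSpace G] [MeasurableSpace G]
  [BorelSpace G]

/-- The Ashtekar-Lewandowski measure on the space of generalized connections, characterized by its
law: the holonomy along an edge `s` is Haar distributed and independent of the holonomies along any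
finite family of edges that meet `s` at most in its end points. In particular, the holonomies along
the edges of a graph are independent and Haar distributed. -/
structure IsAshtekarLewandowski (μ : Measure (GenConn d M G)) : Prop where
  isProbabilityMeasure : IsProbabilityMeasure μ
  law : ∀ (s : Edge d M) (F : Finset (Edge d M)),
    (∀ e ∈ F, e.carrier ∩ s.carrier ⊆ {s.source, s.target}) →
    μ.map (fun A => (A.val s, hol F A)) = (haarProb G).prod (μ.map (hol F))

/-- The kinematical Hilbert space `L²` of the space of generalized connections. -/
abbrev HAL (μ : Measure (GenConn d M G)) : Type _ := Lp ℂ 2 μ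

variable (μ : Measure (GenConn d M G))

/-- The gauge-invariant cylindrical functions on `γ`: continuous functions of the holonomies along
the edges of `γ` that are invariant under all gauge transformations. -/
def Cyl (γ : Graph d M) : Submodule ℂ (HAL μ) where
  carrier := {ψ | ∃ F : (γ.edges → G) → ℂ, Continuous F ∧
    (∀ (g : M → G) (A : GenConn d M G), F (hol γ.edges (gauge g A)) = F (hol γ.edges A)) ∧
    ψ =ᵐ[μ] fun A => F (hol γ.edges A)}
  zero_mem' := ⟨0, continuous_zero, fun _ _ => rfl, Lp.coeFn_zero _ _ _⟩
  add_mem' := by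
    rintro ψ χ ⟨F, hF, hF', hψ⟩ ⟨K, hK, hK', hχ⟩
    refine ⟨F + K, hF.add hK, fun g A => by simp [hF' g A, hK' g A], ?_⟩
    filter_upwards [Lp.coeFn_add ψ χ, hψ, hχ] with A h₁ h₂ h₃
    rw [h₁, Pi.add_apply, h₂, h₃, Pi.add_apply]
  smul_mem' := by
    rintro z ψ ⟨F, hF, hF', hψ⟩
    refine ⟨z • F, hF.const_smul z, fun g A => by simp [hF' g A], ?_⟩
    filter_upwards [Lp.coeFn_smul z ψ, hψ] with A h₁ h₂
    rw [h₁, Pi.smul_apply, h₂, Pi.smul_apply]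

/-- The Hilbert space `H_γ` of a graph: the closure of the cylindrical functions on it. -/
abbrev Hgr (γ : Graph d M) : Submodule ℂ (HAL μ) := (Cyl μ γ).topologicalClosure

/-- The subspace `H'_γ` of those states in `H_γ` that are orthogonal to `H_γ'` for every graph `γ'`
properly contained in `γ`. -/
def Hgr' (γ : Graph d M) : Submodule ℂ (HAL μ) :=
  Hgr μ γ ⊓ (⨆ (γ' : Graph d M) (_ : γ'.support ⊂ γ.support), Hgr μ γ')ᗮ

open scoped Classical in
/-- The action `(U_φ ψ)(A) = ψ(φ^* A)` of a diffeomorphism on the kinematical Hilbert space, which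
maps functions of the holonomies along edges `e` to functions of the holonomies along `φ(e)`. (The
Ashtekar-Lewandowski measure is preserved by diffeomorphisms; the second branch is not
used for it.) -/
def unitaryDiff [IsManifold (𝓡 d) ω M] (φ : Diff d M) : HAL μ →ₗ[ℂ] HAL μ :=
  if h : MeasurePreserving (pullback (G := G) φ) μ μ then
    Lp.compMeasurePreservingₗ ℂ (pullback φ) h
  else 0

/-! ### Diffeomorphism-invariant states -/

/-- The data of a diffeomorphism-invariant state `|Ψ) = ∑_{γ ∈ S} |η(Ψ_γ))`: a set `S` of graphs
and, for `γ ∈ S`, a state `Ψ_γ ∈ H'_γ` that is invariant under the symmetries of `γ`. The set may be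
infinite, but only finitely many of its elements are diffeomorphic to any given graph. -/
structure DiffInvState [IsManifold (𝓡 d) ω M] where
  S : Set (Graph d M)
  comp : Graph d M → HAL μ
  comp_mem : ∀ γ ∈ S, comp γ ∈ Hgr' μ γ
  comp_inv : ∀ γ ∈ S, ∀ φ ∈ γ.stab, unitaryDiff μ φ (comp γ) = comp γ
  locallyFinite : ∀ α : Graph d M, {γ ∈ S | ∃ φ : Diff d M, φ • γ.support = α.support}.Finite

namespace DiffInvState

variable {μ} [IsManifold (𝓡 d) ω M] (Ψ : DiffInvState μ)

/-- The pairs of a graph `γ ∈ S` and a class `[φ]` in `Diff / Diff_γ`, where `Diff_γ` consists of the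
diffeomorphisms that map `γ` onto itself. -/
abbrev Index : Type _ := Σ γ : Ψ.S, Diff d M ⧸ (γ : Graph d M).stab

/-- The state `U_φ Ψ_γ`; by the invariance of `Ψ_γ` it depends on the class of `φ` only. -/
def term (p : Ψ.Index) : HAL μ := unitaryDiff μ p.2.out (Ψ.comp p.1)

/-- The point set of the graph `φ(γ)`. -/
def image (p : Ψ.Index) : Set M := p.2.out • (p.1 : Graph d M).support

/-- The value `(Ψ|f⟩ = ∑_{γ ∈ S} ∑_{[φ] ∈ Diff / Diff_γ} ⟨U_φ Ψ_γ, f⟩` of the functional `(Ψ|` on a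
state `f`, where `η(Ψ_γ)` is the sum over `[φ]` by the definition of the rigging map. -/
def pairing (f : HAL μ) : ℂ := ∑ᶠ p : Ψ.Index, ⟪Ψ.term p, f⟫_ℂ

/-- The component `Ψ̃_α`: the sum of `U_φ Ψ_γ` over all `γ ∈ S` and `[φ]` with `φ(γ) = α`. -/
def component (α : Graph d M) : HAL μ :=
  ∑ᶠ (p : Ψ.Index) (_ : Ψ.image p = α.support), Ψ.term p

/-- The kinematical state `Ψ̃`: the sum of the components `Ψ̃_α` over all subgraphs `α` of `γ₀`. -/
def kin (γ₀ : Graph d M) : HAL μ := ∑ F ∈ γ₀.edges.powerset, Ψ.component (γ₀.subgraph F)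

end DiffInvState

/-! ### Hamilton constraints and the quadratic constraint -/

/-- A family of (in general unbounded) operators on the kinematical Hilbert space, labelled by the
lapse functions `N : M → ℝ`, with a common domain. -/
structure ConstraintFamily where
  dom : Submodule ℂ (HAL μ)
  op : (M → ℝ) → dom →ₗ[ℂ] HAL μ

namespace ConstraintFamily

variable {μ} (H : ConstraintFamily μ)

/-- Graph-preserving: `H(N)` maps `H_γ ∩ dom` to `H_γ` for every graph `γ`. -/
def GraphPreserving : Prop :=
  ∀ (γ : Graph d M) (N : M → ℝ) (f : H.dom), (f : HAL μ) ∈ Hgr μ γ → H.op N f ∈ Hgr μ γ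

/-- The common domain is dense in `H_γ`. -/
def DenselyDefinedOn (γ : Graph d M) : Prop := Hgr μ γ ≤ (H.dom ⊓ Hgr μ γ).topologicalClosure

open scoped Classical in
/-- The operator `H_v = H(δ_v)`, where `δ_v` is the Kronecker delta function at `v`. -/
def vertexOp (v : M) : HAL μ →ₗ.[ℂ] HAL μ := ⟨H.dom, H.op (Pi.single v 1)⟩

/-- On `H_γ`, the constraints are sums over vertices: `H(N) f = ∑_{v ∈ V(γ)} N(v) H_v f`. -/
def IsVertexSumOn (γ : Graph d M) : Prop :=
  ∀ (N : M → ℝ) (f : H.dom), (f : HAL μ) ∈ Hgr μ γ →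
    H.op N f = ∑ v ∈ γ.vertices, (N v : ℂ) • H.vertexOp v f

end ConstraintFamily

end Kinematics

section Operators

variable {E : Type*} [NormedAddCommGroup E] [InnerProductSpace ℂ E]

/-- The restriction `P T P` of an operator to a closed subspace with projector `P`, with its natural
domain. -/
def compress (K : Submodule ℂ E) [K.HasOrthogonalProjection] (T : E →ₗ.[ℂ] E) : E →ₗ.[ℂ] E where
  domain := T.domain.comap (K.starProjection : E →ₗ[ℂ] E)
  toFun := (K.starProjection : E →ₗ[ℂ] E) ∘ₗ T.toFun ∘ₗ
    (K.starProjection : E →ₗ[ℂ] E).restrict (fun _ hx => hx)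

/-- The operator `T T†` with its natural domain. -/
def mulAdjoint [CompleteSpace E] (T : E →ₗ.[ℂ] E) : E →ₗ.[ℂ] E where
  domain :=
    { carrier := {x | ∃ h : x ∈ T.adjoint.domain, T.adjoint ⟨x, h⟩ ∈ T.domain}
      zero_mem' := ⟨zero_mem _, by
        have h : T.adjoint ⟨0, zero_mem _⟩ = 0 := T.adjoint.map_zero
        rw [h]; exact zero_mem _⟩
      add_mem' := by
        rintro x y ⟨hx, hx'⟩ ⟨hy, hy'⟩
        refine ⟨add_mem hx hy, ?_⟩
        have h : T.adjoint ⟨x + y, add_mem hx hy⟩ = T.adjoint ⟨x, hx⟩ + T.adjoint ⟨y, hy⟩ :=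
          T.adjoint.map_add ⟨x, hx⟩ ⟨y, hy⟩
        rw [h]; exact add_mem hx' hy'
      smul_mem' := by
        rintro z x ⟨hx, hx'⟩
        refine ⟨Submodule.smul_mem _ z hx, ?_⟩
        have h : T.adjoint ⟨z • x, Submodule.smul_mem _ z hx⟩ = z • T.adjoint ⟨x, hx⟩ :=
          T.adjoint.map_smul z ⟨x, hx⟩
        rw [h]; exact Submodule.smul_mem _ z hx' }
  toFun :=
    { toFun := fun x => T ⟨T.adjoint ⟨x, x.2.1⟩, x.2.2⟩
      map_add' := fun x y => by
        rw [← T.map_add]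
        congr 1
        exact Subtype.ext (T.adjoint.map_add ⟨x, x.2.1⟩ ⟨y, y.2.1⟩)
      map_smul' := fun z x => by
        rw [RingHom.id_apply, ← T.map_smul]
        congr 1
        exact Subtype.ext (T.adjoint.map_smul z ⟨x, x.2.1⟩) }

/-- The expectation value of `T` in the (not necessarily normalized) state `x` exists and is `z`. -/
def HasExpectation (T : E →ₗ.[ℂ] E) (x : E) (z : ℂ) : Prop :=
  ∃ h : x ∈ T.domain, ⟪x, T ⟨x, h⟩⟫_ℂ = z

end Operators

section Quadratic

variable {d : ℕ} {M : Type*} [TopologicalSpace M] [ChartedSpace (EuclideanSpace ℝ (Fin d)) M]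
  {G : Type*} [Group G] [TopologicalSpace G] [IsTopologicalGroup G] [CompactSpace G]
  [MeasurableSpace G] [BorelSpace G] {μ : Measure (GenConn d M G)}

/-- The restriction `H_v|_{H_γ} = P_γ H_v P_γ`. -/
def ConstraintFamily.restrictedOp (H : ConstraintFamily μ) (γ : Graph d M) (v : M) :
    HAL μ →ₗ.[ℂ] HAL μ :=
  compress (Hgr μ γ) (H.vertexOp v)

/-- The quadratic constraint `Q = ∑_{v ∈ V(γ)} H_v|_{H_γ} (H_v|_{H_γ})†`. -/
def ConstraintFamily.quadratic (H : ConstraintFamily μ) (γ : Graph d M) : HAL μ →ₗ.[ℂ] HAL μ :=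
  ∑ v ∈ γ.vertices, mulAdjoint (H.restrictedOp γ v)

end Quadratic

end

end LQG

/-!
On `H_γ₀` the functional `(Ψ|` is the inner product with the kinematical state `Ψ̃`
(`DiffInvState.pairing_eq_inner_kin`). Since `H(N)` preserves `H_γ₀` and is a sum over vertices there,
the constraints hold if and only if `Ψ̃` is orthogonal to the ranges of all `H_v` on `H_γ₀`, that is,
if and only if `Ψ̃` is annihilated by all adjoints `T_v†`, where `T_v = P H_v P` is densely defined.
As `⟨Ψ̃, T_v T_v† Ψ̃⟩ = ‖T_v† Ψ̃‖²`, this is the vanishing of the expectation value of the quadratic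
constraint (`hasExpectation_sum_mulAdjoint_zero`).

The reduction of `(Ψ|` to finitely many terms rests on an orthogonality statement
(`IsAshtekarLewandowski.inner_eq_zero_of_ne`): a state `ψ ∈ H'_β` is orthogonal to `H_γ` unless `β` is,
as a point set, formed by edges of `γ`. For its proof, cut `γ` into finitely many pieces each of which
lies inside or outside of `β`. This is possible because two analytic arcs meet in finitely many
points and arcs: near a common point, the parameter of the second arc is an analytic function of the
parameter of the first one wherever they meet, and an analytic function that does not vanish
identically has isolated zeros
(`eventually_isLocallyDecided`, `Graph.isFinitelyCut_support`). A cylindrical function on `γ` is one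
on the subdivision, and the holonomies along the pieces outside of `β` can be integrated out without
changing inner products with states on `β` (`exists_inner_eq_of_erase`), because they are independent
of the holonomies along all edges of `β`. What remains is a function on a graph contained in `β`. If
this graph is smaller than `β`, it is orthogonal to `ψ` by the definition of `H'_β`. Otherwise, if `β`
is not formed by edges of `γ`, the remaining graph ends in an interior point of an edge of `γ`; this
end point has valence one, a gauge transformation makes the holonomy at it trivial
(`IsHolFun.erase_of_univalent`), and again one arrives at a proper subset of `β`.

Two further facts are needed. The space `H_γ` depends on the point set of `γ` only
(`Cyl_le_of_support_eq`): subdividing a graph yields no new gauge-invariant functions, because a gauge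
transformation at a bivalent vertex makes one of the two holonomies trivial. And diffeomorphisms
preserve the Ashtekar-Lewandowski measure, because it is determined by its characterization
(`IsAshtekarLewandowski.unique`): any finite family of edges decomposes into the edges of one graph,
and the joint law of the holonomies of a graph is given by the independence property.

Arcs are handled by induction on their construction from analytic arcs and by connectedness, without
global parametrizations. The main tools are that an arc can be cut at each interior point, and that
a connected subset of an arc that contains both end points is the whole arc.
-/

namespace LQG

/-! ### Topology of embedded arcs -/

section Arcs

variable {d : ℕ} {M : Type*} [TopologicalSpace M] [ChartedSpace (EuclideanSpace ℝ (Fin d)) M]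
  {S T J : Set M} {x y z : M}

theorem IsAnalyticArc.restrict {a b s t : ℝ} {c : ℝ → M}
    (hc : ContMDiffOn 𝓘(ℝ, ℝ) (𝓡 d) ω c (Set.Icc a b)) (hinj : Set.InjOn c (Set.Icc a b))
    (hder : ∀ u ∈ Set.Icc a b, mfderivWithin 𝓘(ℝ, ℝ) (𝓡 d) c (Set.Icc a b) u ≠ 0)
    (has : a ≤ s) (hst : s < t) (htb : t ≤ b) :
    IsAnalyticArc d (c '' Set.Icc s t) (c s) (c t) := by
  have hsub : Set.Icc s t ⊆ Set.Icc a b := Set.Icc_subset_Icc has htb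
  refine ⟨s, t, c, hst, hc.mono hsub, hinj.mono hsub, fun u hu => ?_, rfl, rfl, rfl⟩
  have h := ((hc u (hsub hu)).mdifferentiableWithinAt (by simp)).mfderivWithin_mono
    ((uniqueDiffOn_Icc hst u hu).uniqueMDiffWithinAt) hsub
  rw [h]
  exact hder u (hsub hu)

theorem IsArc.source_mem (h : IsArc d S x y) : x ∈ S := by
  induction h with
  | analytic h =>
    obtain ⟨a, b, c, hab, -, -, -, rfl, rfl, rfl⟩ := h
    exact ⟨a, Set.left_mem_Icc.2 hab.le, rfl⟩
  | concat _ _ _ ih₁ _ => exact Or.inl ih₁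

theorem IsArc.target_mem (h : IsArc d S x y) : y ∈ S := by
  induction h with
  | analytic h =>
    obtain ⟨a, b, c, hab, -, -, -, rfl, rfl, rfl⟩ := h
    exact ⟨b, Set.right_mem_Icc.2 hab.le, rfl⟩
  | concat _ _ _ _ ih₂ => exact Or.inr ih₂

theorem IsArc.source_ne_target (h : IsArc d S x y) : x ≠ y := by
  induction h with
  | analytic h =>
    obtain ⟨a, b, c, hab, -, hinj, -, rfl, rfl, rfl⟩ := h
    exact fun h => hab.ne (hinj (Set.left_mem_Icc.2 hab.le) (Set.right_mem_Icc.2 hab.le) h)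
  | @concat S T x y z h₁ h₂ hST ih₁ _ =>
    rintro rfl
    have : x ∈ S ∩ T := ⟨h₁.source_mem, h₂.target_mem⟩
    rw [hST] at this
    exact ih₁ this

theorem IsArc.isCompact (h : IsArc d S x y) : IsCompact S := by
  induction h with
  | analytic h =>
    obtain ⟨a, b, c, hab, hc, -, -, rfl, rfl, rfl⟩ := h
    exact isCompact_Icc.image_of_continuousOn hc.continuousOn
  | concat _ _ _ ih₁ ih₂ => exact ih₁.union ih₂

/-- The interior of an arc is dense in it. -/
theorem IsArc.subset_closure_diff (h : IsArc d S x y) : S ⊆ closure (S \ {x, y}) := by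
  induction h with
  | analytic h =>
    obtain ⟨a, b, c, hab, hc, hinj, -, rfl, rfl, rfl⟩ := h
    have hsub : c '' Set.Ioo a b ⊆ c '' Set.Icc a b \ {c a, c b} := by
      rintro _ ⟨t, ht, rfl⟩
      refine ⟨⟨t, Set.Ioo_subset_Icc_self ht, rfl⟩, ?_⟩
      rintro (h | h)
      · exact ht.1.ne' (hinj (Set.Ioo_subset_Icc_self ht) (Set.left_mem_Icc.2 hab.le) h)
      · exact ht.2.ne (hinj (Set.Ioo_subset_Icc_self ht) (Set.right_mem_Icc.2 hab.le) h)
    refine Set.Subset.trans ?_ (closure_mono hsub)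
    rw [← closure_Ioo hab.ne] at hc ⊢
    exact hc.continuousOn.image_closure
  | @concat S T x y z h₁ h₂ hST ih₁ ih₂ =>
    refine Set.union_subset (ih₁.trans (closure_mono ?_)) (ih₂.trans (closure_mono ?_))
    · rintro p ⟨hp, hp'⟩
      refine ⟨Or.inl hp, ?_⟩
      rintro (rfl | rfl)
      · exact hp' (Or.inl rfl)
      · have : p ∈ S ∩ T := ⟨hp, h₂.target_mem⟩
        rw [hST] at this
        exact hp' (Or.inr this)
    · rintro p ⟨hp, hp'⟩
      refine ⟨Or.inr hp, ?_⟩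
      rintro (rfl | rfl)
      · have : p ∈ S ∩ T := ⟨h₁.source_mem, hp⟩
        rw [hST] at this
        exact hp' (Or.inl this)
      · exact hp' (Or.inr rfl)

theorem IsArc.isPreconnected_diff (h : IsArc d S x y) : IsPreconnected (S \ {x, y}) := by
  induction h with
  | analytic h =>
    obtain ⟨a, b, c, hab, hc, hinj, -, rfl, rfl, rfl⟩ := h
    have heq : c '' Set.Icc a b \ {c a, c b} = c '' Set.Ioo a b := by
      apply Set.Subset.antisymm
      · rintro _ ⟨⟨t, ht, rfl⟩, h⟩
        refine ⟨t, ⟨ht.1.lt_of_ne ?_, ht.2.lt_of_ne ?_⟩, rfl⟩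
        · rintro rfl; exact h (Or.inl rfl)
        · rintro rfl; exact h (Or.inr rfl)
      · rintro _ ⟨t, ht, rfl⟩
        refine ⟨⟨t, Set.Ioo_subset_Icc_self ht, rfl⟩, ?_⟩
        rintro (h | h)
        · exact ht.1.ne' (hinj (Set.Ioo_subset_Icc_self ht) (Set.left_mem_Icc.2 hab.le) h)
        · exact ht.2.ne (hinj (Set.Ioo_subset_Icc_self ht) (Set.right_mem_Icc.2 hab.le) h)
    rw [heq]
    exact isPreconnected_Ioo.image _ (hc.continuousOn.mono Set.Ioo_subset_Icc_self)
  | @concat S T x y z h₁ h₂ hST ih₁ ih₂ =>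
    have hS : IsPreconnected (S \ {x}) := ih₁.subset_closure
      (Set.sdiff_subset_sdiff_right (by simp)) (Set.sdiff_subset.trans h₁.subset_closure_diff)
    have hT : IsPreconnected (T \ {z}) := ih₂.subset_closure
      (Set.sdiff_subset_sdiff_right (by simp)) (Set.sdiff_subset.trans h₂.subset_closure_diff)
    have heq : (S ∪ T) \ {x, z} = S \ {x} ∪ T \ {z} := by
      have hx : x ∉ T := fun hx => h₁.source_ne_target
        (by have : x ∈ S ∩ T := ⟨h₁.source_mem, hx⟩
            rwa [hST] at this)
      have hz : z ∉ S := fun hz => h₂.source_ne_target.symm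
        (by have : z ∈ S ∩ T := ⟨hz, h₂.target_mem⟩
            rwa [hST] at this)
      ext p
      simp only [Set.mem_sdiff, Set.mem_union, Set.mem_insert_iff, Set.mem_singleton_iff]
      constructor
      · tauto
      · rintro (⟨hp, hp'⟩ | ⟨hp, hp'⟩)
        · exact ⟨Or.inl hp, by rintro (h | rfl) <;> tauto⟩
        · exact ⟨Or.inr hp, by rintro (rfl | h) <;> tauto⟩
    rw [heq]
    exact hS.union y ⟨h₁.target_mem, fun h => h₁.source_ne_target h.symm⟩
      ⟨h₂.source_mem, fun h => h₂.source_ne_target h⟩ hT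

theorem IsArc.isPreconnected_of_diff_subset (h : IsArc d S x y) (hJ : S \ {x, y} ⊆ J)
    (hJS : J ⊆ S) : IsPreconnected J :=
  h.isPreconnected_diff.subset_closure hJ (hJS.trans h.subset_closure_diff)

theorem IsArc.nonempty_diff (h : IsArc d S x y) : (S \ {x, y}).Nonempty :=
  closure_nonempty_iff.1 ⟨x, h.subset_closure_diff h.source_mem⟩

/-- An arc can be cut at each interior point. -/
theorem IsArc.split (h : IsArc d S x y) (hz : z ∈ S) (hzx : z ≠ x) (hzy : z ≠ y) :
    ∃ S₁ S₂, IsArc d S₁ x z ∧ IsArc d S₂ z y ∧ S₁ ∩ S₂ = {z} ∧ S₁ ∪ S₂ = S := by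
  induction h generalizing z with
  | analytic h =>
    obtain ⟨a, b, c, hab, hc, hinj, hder, rfl, rfl, rfl⟩ := h
    obtain ⟨t, ht, rfl⟩ := hz
    have hat : a < t := ht.1.lt_of_ne (by rintro rfl; exact hzx rfl)
    have htb : t < b := ht.2.lt_of_ne (by rintro rfl; exact hzy rfl)
    refine ⟨_, _, .analytic (IsAnalyticArc.restrict hc hinj hder le_rfl hat htb.le),
      .analytic (IsAnalyticArc.restrict hc hinj hder hat.le htb le_rfl), ?_, ?_⟩
    · rw [← hinj.image_inter (Set.Icc_subset_Icc_right htb.le) (Set.Icc_subset_Icc_left hat.le),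
        Set.Icc_inter_Icc_eq_singleton hat.le htb.le, Set.image_singleton]
    · rw [← Set.image_union, Set.Icc_union_Icc_eq_Icc hat.le htb.le]
  | @concat S T x y w h₁ h₂ hST ih₁ ih₂ =>
    by_cases hy : z = y
    · subst hy
      exact ⟨S, T, h₁, h₂, hST, rfl⟩
    rcases hz with hz | hz
    · obtain ⟨S₁, S₂, h₃, h₄, hi, rfl⟩ := ih₁ hz hzx hy
      have hyS : y ∉ S₁ := fun h => hy (by
        have : y ∈ S₁ ∩ S₂ := ⟨h, h₄.target_mem⟩
        rw [hi] at this
        exact this.symm)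
      refine ⟨S₁, S₂ ∪ T, h₃, .concat h₄ h₂ ?_, ?_, (Set.union_assoc _ _ _).symm⟩
      · refine Set.Subset.antisymm ?_ (Set.singleton_subset_iff.2 ⟨h₄.target_mem, h₂.source_mem⟩)
        rw [← hST]
        exact Set.inter_subset_inter_left _ Set.subset_union_right
      · rw [Set.inter_union_distrib_left, hi, Set.union_eq_left]
        rintro p ⟨hp, hpT⟩
        have : p ∈ (S₁ ∪ S₂) ∩ T := ⟨Or.inl hp, hpT⟩
        rw [hST] at this
        exact absurd ((show p = y from this) ▸ hp) hyS
    · obtain ⟨T₁, T₂, h₃, h₄, hi, rfl⟩ := ih₂ hz hy hzy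
      have hyT : y ∉ T₂ := fun h => hy (by
        have : y ∈ T₁ ∩ T₂ := ⟨h₃.source_mem, h⟩
        rw [hi] at this
        exact this.symm)
      refine ⟨S ∪ T₁, T₂, .concat h₁ h₃ ?_, h₄, ?_, Set.union_assoc _ _ _⟩
      · refine Set.Subset.antisymm ?_ (Set.singleton_subset_iff.2 ⟨h₁.target_mem, h₃.source_mem⟩)
        rw [← hST]
        exact Set.inter_subset_inter_right _ Set.subset_union_left
      · rw [Set.union_inter_distrib_right, hi, Set.union_eq_right]
        rintro p ⟨hpS, hp⟩
        have : p ∈ S ∩ (T₁ ∪ T₂) := ⟨hpS, Or.inr hp⟩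
        rw [hST] at this
        exact absurd ((show p = y from this) ▸ hp) hyT

/-- A connected set that is covered by two closed sets with at most the point `z` in common, and that
misses `z`, lies in either of the two that it meets. -/
theorem subset_left_of_split {S₁ S₂ : Set M} (h₁ : IsClosed S₁) (h₂ : IsClosed S₂)
    (hi : S₁ ∩ S₂ ⊆ {z}) (hJ : IsPreconnected J) (hJS : J ⊆ S₁ ∪ S₂) (hz : z ∉ J)
    (hx : x ∈ J) (hxS : x ∈ S₁) : J ⊆ S₁ := by
  have hd : J ∩ (S₁ ∩ S₂) = ∅ := by
    refine Set.eq_empty_of_forall_notMem ?_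
    rintro p ⟨hp, hp'⟩
    exact hz ((show p = z from hi hp') ▸ hp)
  rcases isPreconnected_iff_subset_of_disjoint_closed.1 hJ _ _ h₁ h₂ hJS hd with h | h
  · exact h
  · exact absurd (show x ∈ J ∩ (S₁ ∩ S₂) from ⟨hx, hxS, h hx⟩) (by simp [hd])

variable [T2Space M]

theorem IsArc.isClosed (h : IsArc d S x y) : IsClosed S := h.isCompact.isClosed

/-- A connected subset of an arc that contains both end points is the whole arc. -/
theorem IsArc.eq_of_isPreconnected (h : IsArc d S x y) (hJ : IsPreconnected J) (hJS : J ⊆ S)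
    (hx : x ∈ J) (hy : y ∈ J) : J = S := by
  refine hJS.antisymm fun z hz => ?_
  by_contra hzJ
  obtain ⟨S₁, S₂, h₁, h₂, hi, rfl⟩ := h.split hz (by rintro rfl; exact hzJ hx)
    (by rintro rfl; exact hzJ hy)
  have hJ₁ := subset_left_of_split h₁.isClosed h₂.isClosed hi.subset hJ hJS hzJ hx h₁.source_mem
  have : y ∈ S₁ ∩ S₂ := ⟨hJ₁ hy, h₂.target_mem⟩
  rw [hi] at this
  exact h₂.source_ne_target this.symm

/-- An arc that starts at an end point `x` of the arc `S` and stays in `S` is an initial piece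
of `S`: a connected subset of `S` that contains `x` but not the other end of the arc lies in
the arc. -/
theorem IsArc.subset_of_initial {s : Set M} {u v : M} (h : IsArc d S u v) (hx : x = u ∨ x = v)
    (hs : IsArc d s x y ∨ IsArc d s y x) (hsS : s ⊆ S) (hJ : IsPreconnected J) (hJS : J ⊆ S)
    (hxJ : x ∈ J) (hyJ : y ∉ J) : J ⊆ s := by
  have hsP : IsPreconnected s := by
    rcases hs with hs | hs <;> exact hs.isPreconnected_of_diff_subset Set.sdiff_subset subset_rfl
  have hxs : x ∈ s := by rcases hs with hs | hs; exacts [hs.source_mem, hs.target_mem]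
  have hys : y ∈ s := by rcases hs with hs | hs; exacts [hs.target_mem, hs.source_mem]
  have hxy : x ≠ y := by rcases hs with hs | hs; exacts [hs.source_ne_target, hs.source_ne_target.symm]
  by_cases hyu : y = u
  · subst hyu
    obtain rfl : x = v := hx.resolve_left hxy
    rwa [h.eq_of_isPreconnected hsP hsS hys hxs]
  by_cases hyv : y = v
  · subst hyv
    obtain rfl : x = u := hx.resolve_right hxy
    rwa [h.eq_of_isPreconnected hsP hsS hxs hys]
  obtain ⟨S₁, S₂, h₁, h₂, hi, rfl⟩ := h.split (hsS hys) hyu hyv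
  have hsd : IsPreconnected (s \ {y}) := by
    rcases hs with hs | hs <;>
      exact hs.isPreconnected_of_diff_subset (Set.sdiff_subset_sdiff_right (by simp)) Set.sdiff_subset
  -- The side of `y` that contains `x` is the arc `s`.
  have key : ∀ {A B : Set M}, (IsArc d A x y ∨ IsArc d A y x) → IsClosed A → IsClosed B →
      A ∩ B = {y} → S₁ ∪ S₂ = A ∪ B → J ⊆ s := by
    intro A B hA hAc hBc hAB hU
    rw [hU] at hJS hsS
    have hxA : x ∈ A := by rcases hA with h | h; exacts [h.source_mem, h.target_mem]
    have hyA : y ∈ A := by rcases hA with h | h; exacts [h.target_mem, h.source_mem]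
    have hJA : J ⊆ A := subset_left_of_split hAc hBc hAB.subset hJ hJS hyJ hxJ hxA
    have hsA : s ⊆ A := by
      have h := subset_left_of_split hAc hBc hAB.subset hsd (Set.sdiff_subset.trans hsS)
        (fun h => h.2 rfl) ⟨hxs, hxy⟩ hxA
      intro p hp
      by_cases hpy : p = y
      · rwa [hpy]
      · exact h ⟨hp, hpy⟩
    have : s = A := by
      rcases hA with h | h
      exacts [h.eq_of_isPreconnected hsP hsA hxs hys, h.eq_of_isPreconnected hsP hsA hys hxs]
    rwa [this]
  rcases hx with rfl | rfl
  · exact key (Or.inl h₁) h₁.isClosed h₂.isClosed hi rfl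
  · exact key (Or.inr h₂) h₂.isClosed h₁.isClosed (by rw [Set.inter_comm, hi])
      (Set.union_comm _ _)

end Arcs

/-! ### Graphs and their subdivisions -/

section Graphs

variable {d : ℕ} {M : Type*} [TopologicalSpace M] [ChartedSpace (EuclideanSpace ℝ (Fin d)) M]

/-- An edge without its end points. -/
def Edge.inner (e : Edge d M) : Set M := e.carrier \ {e.source, e.target}

theorem Edge.inner_subset (e : Edge d M) : e.inner ⊆ e.carrier := Set.sdiff_subset

theorem Edge.isPreconnected_inner (e : Edge d M) : IsPreconnected e.inner :=
  e.isArc.isPreconnected_diff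

theorem Edge.isPreconnected_carrier (e : Edge d M) : IsPreconnected e.carrier :=
  e.isArc.isPreconnected_of_diff_subset Set.sdiff_subset subset_rfl

theorem Edge.inner_nonempty (e : Edge d M) : e.inner.Nonempty := e.isArc.nonempty_diff

theorem Edge.carrier_subset_of_inner_subset {e : Edge d M} {K : Set M} (hK : IsClosed K)
    (h : e.inner ⊆ K) : e.carrier ⊆ K :=
  e.isArc.subset_closure_diff.trans (closure_minimal h hK)

/-- An edge cut at an interior point, as a pair of edges with the induced orientation. -/
theorem Edge.exists_split (e : Edge d M) {x : M} (hx : x ∈ e.inner) :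
    ∃ e₁ e₂ : Edge d M, e₁.source = e.source ∧ e₁.target = x ∧ e₂.source = x ∧
      e₂.target = e.target ∧ e₁.carrier ∩ e₂.carrier = {x} ∧
      e.carrier = e₁.carrier ∪ e₂.carrier := by
  obtain ⟨S₁, S₂, h₁, h₂, hi, hu⟩ := e.isArc.split hx.1 (fun h => hx.2 (Or.inl h))
    (fun h => hx.2 (Or.inr h))
  exact ⟨⟨S₁, _, _, h₁⟩, ⟨S₂, _, _, h₂⟩, rfl, rfl, rfl, rfl, hi, hu.symm⟩

namespace Graph

variable (γ : Graph d M)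

theorem mem_support {x : M} : x ∈ γ.support ↔ ∃ e ∈ γ.edges, x ∈ e.carrier := by
  simp [Graph.support]

theorem carrier_subset_support {γ : Graph d M} {e : Edge d M} (he : e ∈ γ.edges) :
    e.carrier ⊆ γ.support := fun _ hx => γ.mem_support.2 ⟨e, he, hx⟩

theorem mem_vertices {x : M} :
    x ∈ γ.vertices ↔ ∃ e ∈ γ.edges, x = e.source ∨ x = e.target := by
  classical
  simp only [Graph.vertices, Finset.mem_union, Finset.mem_image]
  constructor
  · rintro (⟨e, he, rfl⟩ | ⟨e, he, rfl⟩)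
    exacts [⟨e, he, Or.inl rfl⟩, ⟨e, he, Or.inr rfl⟩]
  · rintro ⟨e, he, rfl | rfl⟩
    exacts [Or.inl ⟨e, he, rfl⟩, Or.inr ⟨e, he, rfl⟩]

theorem source_mem_vertices {γ : Graph d M} {e : Edge d M} (he : e ∈ γ.edges) :
    e.source ∈ γ.vertices := γ.mem_vertices.2 ⟨e, he, Or.inl rfl⟩

theorem target_mem_vertices {γ : Graph d M} {e : Edge d M} (he : e ∈ γ.edges) :
    e.target ∈ γ.vertices := γ.mem_vertices.2 ⟨e, he, Or.inr rfl⟩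

theorem vertices_subset_support : (γ.vertices : Set M) ⊆ γ.support := by
  intro x hx
  obtain ⟨e, he, rfl | rfl⟩ := γ.mem_vertices.1 hx
  exacts [carrier_subset_support he e.isArc.source_mem, carrier_subset_support he e.isArc.target_mem]

variable {γ}

/-- Edges contain no vertices apart from their end points. -/
theorem eq_or_eq_of_mem_vertices {x : M} (hx : x ∈ γ.vertices) {e : Edge d M}
    (he : e ∈ γ.edges) (hxe : x ∈ e.carrier) : x = e.source ∨ x = e.target := by
  obtain ⟨e', he', h⟩ := γ.mem_vertices.1 hx
  by_cases hee : e' = e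
  · rwa [← hee]
  · have hx' : x ∈ e'.carrier := by
      rcases h with rfl | rfl
      exacts [e'.isArc.source_mem, e'.isArc.target_mem]
    exact (γ.disj e he e' he' (Ne.symm hee) ⟨hxe, hx'⟩).1

theorem mem_vertices_of_mem_of_mem {x : M} {e e' : Edge d M} (he : e ∈ γ.edges)
    (he' : e' ∈ γ.edges) (hne : e ≠ e') (hx : x ∈ e.carrier) (hx' : x ∈ e'.carrier) :
    x ∈ γ.vertices :=
  γ.mem_vertices.2 ⟨e, he, (γ.disj e he e' he' hne ⟨hx, hx'⟩).1⟩

theorem notMem_vertices_of_mem_inner {x : M} {e : Edge d M} (he : e ∈ γ.edges)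
    (hx : x ∈ e.inner) : x ∉ γ.vertices := fun h => hx.2 (eq_or_eq_of_mem_vertices h he hx.1)

theorem eq_of_mem_inner {x : M} {e e' : Edge d M} (he : e ∈ γ.edges) (hx : x ∈ e.inner)
    (he' : e' ∈ γ.edges) (hx' : x ∈ e'.carrier) : e' = e := by
  by_contra hne
  exact notMem_vertices_of_mem_inner he hx (mem_vertices_of_mem_of_mem he he' (Ne.symm hne) hx.1 hx')

@[simp] theorem mem_edges_subgraph {F : Finset (Edge d M)} {e : Edge d M} :
    e ∈ (γ.subgraph F).edges ↔ e ∈ γ.edges ∧ e ∈ F := by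
  classical
  simp [Graph.subgraph]

theorem support_subgraph_subset (F : Finset (Edge d M)) :
    (γ.subgraph F).support ⊆ γ.support := by
  intro x hx
  obtain ⟨e, he, hxe⟩ := (mem_support _).1 hx
  exact carrier_subset_support (mem_edges_subgraph.1 he).1 hxe

/-- Subgraphs are determined by their point sets. -/
theorem edges_subset_of_support_subgraph_eq {F F' : Finset (Edge d M)} (hF : F ⊆ γ.edges)
    (h : (γ.subgraph F).support = (γ.subgraph F').support) : F ⊆ F' := by
  intro e he
  obtain ⟨x, hx⟩ := e.inner_nonempty
  have hxF : x ∈ (γ.subgraph F).support :=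
    carrier_subset_support (mem_edges_subgraph.2 ⟨hF he, he⟩) hx.1
  rw [h] at hxF
  obtain ⟨e', he', hx'⟩ := (mem_support _).1 hxF
  rw [mem_edges_subgraph] at he'
  rw [← eq_of_mem_inner (hF he) hx he'.1 hx']
  exact he'.2

/-- The graph with a single edge. -/
def single (e : Edge d M) : Graph d M where
  edges := {e}
  disj := by
    intro a ha b hb hab
    rw [Finset.mem_singleton] at ha hb
    exact absurd (ha.trans hb.symm) hab

theorem support_single (e : Edge d M) : (single e).support = e.carrier := by
  simp [Graph.support, single]

section Closed

variable [T2Space M]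

theorem isClosed_biUnion (E : Finset (Edge d M)) : IsClosed (⋃ e ∈ E, e.carrier) :=
  E.finite_toSet.isClosed_biUnion fun e _ => e.isArc.isClosed

theorem isClosed_support (γ : Graph d M) : IsClosed γ.support := isClosed_biUnion _

/-- A connected subset of a graph that contains no vertices lies in a single edge. -/
theorem exists_edge_of_isPreconnected {J : Set M} (hJ : IsPreconnected J) (hne : J.Nonempty)
    (hJs : J ⊆ γ.support) (hJv : ∀ x ∈ J, x ∉ γ.vertices) : ∃ e ∈ γ.edges, J ⊆ e.carrier := by
  classical
  obtain ⟨x, hx⟩ := hne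
  obtain ⟨e, he, hxe⟩ := γ.mem_support.1 (hJs hx)
  refine ⟨e, he, ?_⟩
  have hcov : J ⊆ e.carrier ∪ ⋃ e' ∈ γ.edges.erase e, e'.carrier := by
    intro y hy
    obtain ⟨e', he', hye⟩ := γ.mem_support.1 (hJs hy)
    by_cases h : e' = e
    · exact Or.inl (h ▸ hye)
    · exact Or.inr (Set.mem_biUnion (Finset.mem_coe.2 (Finset.mem_erase.2 ⟨h, he'⟩)) hye)
  have hdisj : J ∩ (e.carrier ∩ ⋃ e' ∈ γ.edges.erase e, e'.carrier) = ∅ := by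
    refine Set.eq_empty_of_forall_notMem ?_
    rintro y ⟨hy, hye, hy'⟩
    simp only [Set.mem_iUnion, Finset.mem_erase, exists_prop] at hy'
    obtain ⟨e', ⟨hne, he'⟩, hye'⟩ := hy'
    exact hJv y hy (mem_vertices_of_mem_of_mem he he' (Ne.symm hne) hye hye')
  rcases isPreconnected_iff_subset_of_disjoint_closed.1 hJ _ _ e.isArc.isClosed
    (isClosed_biUnion _) hcov hdisj with h | h
  · exact h
  · exact (Set.eq_empty_iff_forall_notMem.1 hdisj x ⟨hx, hxe, h hx⟩).elim

end Closed

end Graph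

end Graphs

/-! ### Functions of finitely many holonomies -/

section Functions

variable {d : ℕ} {M : Type*} [TopologicalSpace M] [ChartedSpace (EuclideanSpace ℝ (Fin d)) M]
  {G : Type*} [Group G] [TopologicalSpace G] {X : Type*} [TopologicalSpace X]
  {E E' : Finset (Edge d M)}

/-- `w` is a continuous function of the holonomies along the edges in `E`. -/
def IsHolFun (E : Finset (Edge d M)) (w : GenConn d M G → X) : Prop :=
  ∃ F : (E → G) → X, Continuous F ∧ ∀ A, w A = F (hol E A)

/-- `w` is invariant under all gauge transformations. -/
def IsGaugeInv (w : GenConn d M G → X) : Prop :=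
  ∀ (g : M → G) (A : GenConn d M G), w (gauge g A) = w A

theorem isHolFun_val {e : Edge d M} (he : e ∈ E) :
    IsHolFun E fun A : GenConn d M G => A.val e :=
  ⟨fun y => y ⟨e, he⟩, continuous_apply _, fun _ => rfl⟩

theorem isHolFun_const (c : X) : IsHolFun E fun _ : GenConn d M G => c :=
  ⟨fun _ => c, continuous_const, fun _ => rfl⟩

/-- A gauge-invariant function of the holonomies along `E'` is a function of the holonomies along
`E` if the former are functions of the latter in a suitable gauge. -/
theorem IsHolFun.of_gauge {w : GenConn d M G → X} (hw : IsHolFun E' w) (hg : IsGaugeInv w)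
    (θ : Edge d M → GenConn d M G → G) (hθ : ∀ e ∈ E', IsHolFun E (θ e))
    (h : ∀ A, ∃ g : M → G, ∀ e ∈ E', (gauge g A).val e = θ e A) : IsHolFun E w := by
  obtain ⟨F, hF, hwF⟩ := hw
  choose! K hK hθK using hθ
  refine ⟨fun y => F fun e => K e y, hF.comp (continuous_pi fun e => hK _ e.2), fun A => ?_⟩
  obtain ⟨g, hgA⟩ := h A
  rw [← hg g A, hwF]
  congr 1
  funext e
  rw [← hθK _ e.2]
  exact hgA _ e.2

theorem IsHolFun.trans {w : GenConn d M G → X} (hw : IsHolFun E' w)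
    (h : ∀ e ∈ E', IsHolFun E fun A : GenConn d M G => A.val e) : IsHolFun E w := by
  obtain ⟨F, hF, hwF⟩ := hw
  choose! K hK hθK using h
  refine ⟨fun y => F fun e => K e y, hF.comp (continuous_pi fun e => hK _ e.2), fun A => ?_⟩
  rw [hwF]
  congr 1
  funext e
  exact hθK _ e.2 A

theorem IsHolFun.mono {w : GenConn d M G → X} (hw : IsHolFun E' w) (h : E' ⊆ E) :
    IsHolFun E w :=
  hw.trans fun _ he => isHolFun_val (h he)

omit [TopologicalSpace G] in
theorem gauge_val_of_ne {g : M → G} {A : GenConn d M G} {e : Edge d M} (hs : g e.source = 1)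
    (ht : g e.target = 1) : (gauge g A).val e = A.val e := by
  simp [gauge, hs, ht]

/-- The holonomy along an edge whose end points are vertices of a graph that contains the edge is a
function of the holonomies of the graph. -/
theorem Graph.isHolFun_val_of_subset [T2Space M] [IsTopologicalGroup G] (γ : Graph d M)
    (e : Edge d M) (he : e.carrier ⊆ γ.support) (hs : e.source ∈ γ.vertices)
    (ht : e.target ∈ γ.vertices) : IsHolFun γ.edges fun A : GenConn d M G => A.val e := by
  classical
  induction hn : (γ.vertices.filter (· ∈ e.carrier)).card using Nat.strong_induction_on
    generalizing e with
  | _ n ih =>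
    by_cases hz : ∃ z ∈ γ.vertices, z ∈ e.inner
    · obtain ⟨z, hzv, hze⟩ := hz
      obtain ⟨e₁, e₂, hs₁, ht₁, hs₂, ht₂, hi, hu⟩ := e.exists_split hze
      have hc₁ : e₁.carrier ⊆ e.carrier := hu ▸ Set.subset_union_left
      have hc₂ : e₂.carrier ⊆ e.carrier := hu ▸ Set.subset_union_right
      have hn₁ : e.target ∉ e₁.carrier := by
        intro h
        have : e.target ∈ e₁.carrier ∩ e₂.carrier := ⟨h, ht₂ ▸ e₂.isArc.target_mem⟩
        rw [hi] at this
        exact hze.2 (Or.inr this.symm)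
      have hn₂ : e.source ∉ e₂.carrier := by
        intro h
        have : e.source ∈ e₁.carrier ∩ e₂.carrier := ⟨hs₁ ▸ e₁.isArc.source_mem, h⟩
        rw [hi] at this
        exact hze.2 (Or.inl this.symm)
      have hlt : ∀ {f : Edge d M} {x : M}, f.carrier ⊆ e.carrier → x ∈ γ.vertices →
          x ∈ e.carrier → x ∉ f.carrier →
          (γ.vertices.filter (· ∈ f.carrier)).card < n := by
        intro f x hf hx hxe hxf
        rw [← hn]
        refine Finset.card_lt_card ⟨Finset.monotone_filter_right _ fun y _ hy => hf hy, fun h => ?_⟩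
        exact hxf (Finset.mem_filter.1 (h (Finset.mem_filter.2 ⟨hx, hxe⟩))).2
      obtain ⟨F₁, hF₁, h₁⟩ := ih _ (hlt hc₁ ht e.isArc.target_mem hn₁) e₁ (hc₁.trans he)
        (hs₁ ▸ hs) (ht₁ ▸ hzv) rfl
      obtain ⟨F₂, hF₂, h₂⟩ := ih _ (hlt hc₂ hs e.isArc.source_mem hn₂) e₂ (hc₂.trans he)
        (hs₂ ▸ hzv) (ht₂ ▸ ht) rfl
      refine ⟨fun y => F₁ y * F₂ y, hF₁.mul hF₂, fun A => ?_⟩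
      exact (A.concat e₁ e₂ e (ht₁.trans hs₂.symm) (ht₁ ▸ hi) hu hs₁.symm ht₂.symm).trans
        (congrArg₂ (· * ·) (h₁ A) (h₂ A))
    · push Not at hz
      obtain ⟨s, hsγ, hes⟩ := Graph.exists_edge_of_isPreconnected e.isPreconnected_inner
        e.inner_nonempty (e.inner_subset.trans he) fun x hx hv => hz x hv hx
      have hes := Edge.carrier_subset_of_inner_subset s.isArc.isClosed hes
      have h₁ := Graph.eq_or_eq_of_mem_vertices hs hsγ (hes e.isArc.source_mem)
      have h₂ := Graph.eq_or_eq_of_mem_vertices ht hsγ (hes e.isArc.target_mem)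
      have hne := e.isArc.source_ne_target
      have hcar : ∀ {a b : M}, a ∈ e.carrier → b ∈ e.carrier → s.source = a → s.target = b →
          e.carrier = s.carrier := by
        rintro a b ha hb rfl rfl
        exact s.isArc.eq_of_isPreconnected e.isPreconnected_carrier hes ha hb
      rcases h₁ with h₁ | h₁ <;> rcases h₂ with h₂ | h₂
      · exact absurd (h₁.trans h₂.symm) hne
      · have : e = s := Edge.ext (hcar e.isArc.source_mem e.isArc.target_mem h₁.symm h₂.symm) h₁ h₂
        exact this ▸ isHolFun_val hsγ
      · refine ⟨fun y => (y ⟨s, hsγ⟩)⁻¹, (continuous_apply _).inv, fun A => ?_⟩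
        exact A.reverse s e (hcar e.isArc.target_mem e.isArc.source_mem h₂.symm h₁.symm) h₁ h₂
      · exact absurd (h₁.trans h₂.symm) hne

/-- Cutting one edge of a graph at an interior point `x` yields no new gauge-invariant functions:
gauge transformations at `x` make the holonomy along the first half trivial. -/
theorem Graph.exists_subdivision_singleton [T2Space M] (G X : Type*) [Group G] [TopologicalSpace G]
    [TopologicalSpace X] (γ : Graph d M) {x : M} (hx : x ∈ γ.support) :
    ∃ γ' : Graph d M, γ'.support = γ.support ∧ γ.vertices ⊆ γ'.vertices ∧ x ∈ γ'.vertices ∧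
      (∀ e' ∈ γ'.edges, ∃ e ∈ γ.edges, e'.carrier ⊆ e.carrier) ∧
      ∀ w : GenConn d M G → X, IsGaugeInv w → IsHolFun γ'.edges w → IsHolFun γ.edges w := by
  classical
  by_cases hxv : x ∈ γ.vertices
  · exact ⟨γ, rfl, subset_rfl, hxv, fun e he => ⟨e, he, subset_rfl⟩, fun _ _ h => h⟩
  obtain ⟨e, he, hxe⟩ := γ.mem_support.1 hx
  have hxi : x ∈ e.inner := by
    refine ⟨hxe, ?_⟩
    rintro (rfl | rfl)
    exacts [hxv (source_mem_vertices he), hxv (target_mem_vertices he)]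
  obtain ⟨e₁, e₂, hs₁, ht₁, hs₂, ht₂, hi, hu⟩ := e.exists_split hxi
  have hc₁ : e₁.carrier ⊆ e.carrier := hu ▸ Set.subset_union_left
  have hc₂ : e₂.carrier ⊆ e.carrier := hu ▸ Set.subset_union_right
  have hn₁ : e.target ∉ e₁.carrier := by
    intro h
    have : e.target ∈ e₁.carrier ∩ e₂.carrier := ⟨h, ht₂ ▸ e₂.isArc.target_mem⟩
    rw [hi] at this
    exact hxi.2 (Or.inr this.symm)
  have hn₂ : e.source ∉ e₂.carrier := by
    intro h
    have : e.source ∈ e₁.carrier ∩ e₂.carrier := ⟨hs₁ ▸ e₁.isArc.source_mem, h⟩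
    rw [hi] at this
    exact hxi.2 (Or.inl this.symm)
  have hr : ∀ r ∈ γ.edges, r.source ≠ x ∧ r.target ≠ x := fun r hr =>
    ⟨fun h => hxv (h ▸ source_mem_vertices hr), fun h => hxv (h ▸ target_mem_vertices hr)⟩
  have h12 : e₁.carrier ∩ e₂.carrier ⊆ {e₁.source, e₁.target} ∩ {e₂.source, e₂.target} := by
    rw [hi, Set.singleton_subset_iff]
    exact ⟨Or.inr ht₁.symm, Or.inl hs₂.symm⟩
  have hr1 : ∀ r ∈ γ.edges, r ≠ e →
      r.carrier ∩ e₁.carrier ⊆ {r.source, r.target} ∩ {e₁.source, e₁.target} := by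
    rintro r hr hre p ⟨hp, hp₁⟩
    have h := γ.disj r hr e he hre ⟨hp, hc₁ hp₁⟩
    refine ⟨h.1, ?_⟩
    rcases h.2 with h | h
    · exact Or.inl (h.trans hs₁.symm)
    · exact absurd ((show p = e.target from h) ▸ hp₁) hn₁
  have hr2 : ∀ r ∈ γ.edges, r ≠ e →
      r.carrier ∩ e₂.carrier ⊆ {r.source, r.target} ∩ {e₂.source, e₂.target} := by
    rintro r hr hre p ⟨hp, hp₁⟩
    have h := γ.disj r hr e he hre ⟨hp, hc₂ hp₁⟩
    refine ⟨h.1, ?_⟩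
    rcases h.2 with h | h
    · exact absurd ((show p = e.source from h) ▸ hp₁) hn₂
    · exact Or.inr (h.trans ht₂.symm)
  have swap : ∀ {A B C D : Set M}, A ∩ B ⊆ C ∩ D → B ∩ A ⊆ D ∩ C := by
    intro A B C D h
    rwa [Set.inter_comm B, Set.inter_comm D]
  let γ' : Graph d M :=
    { edges := insert e₁ (insert e₂ (γ.edges.erase e))
      disj := by
        intro r hr r' hr' hne
        simp only [Finset.mem_insert, Finset.mem_erase] at hr hr'
        rcases hr with rfl | rfl | ⟨hre, hr⟩ <;> rcases hr' with rfl | rfl | ⟨hre', hr'⟩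
        · exact absurd rfl hne
        · exact h12
        · exact swap (hr1 _ hr' hre')
        · exact swap h12
        · exact absurd rfl hne
        · exact swap (hr2 _ hr' hre')
        · exact hr1 _ hr hre
        · exact hr2 _ hr hre
        · exact γ.disj _ hr _ hr' hne }
  have hmem : ∀ {r}, r ∈ γ'.edges ↔ r = e₁ ∨ r = e₂ ∨ (r ≠ e ∧ r ∈ γ.edges) := by
    intro r
    simp [γ']
  have hv : γ.vertices ⊆ γ'.vertices := by
    intro v hv
    obtain ⟨r, hrγ, hvr⟩ := γ.mem_vertices.1 hv
    by_cases hre : r = e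
    · subst hre
      rcases hvr with rfl | rfl
      · exact γ'.mem_vertices.2 ⟨e₁, hmem.2 (Or.inl rfl), Or.inl hs₁.symm⟩
      · exact γ'.mem_vertices.2 ⟨e₂, hmem.2 (Or.inr (Or.inl rfl)), Or.inr ht₂.symm⟩
    · exact γ'.mem_vertices.2 ⟨r, hmem.2 (Or.inr (Or.inr ⟨hre, hrγ⟩)), hvr⟩
  refine ⟨γ', ?_, hv, γ'.mem_vertices.2 ⟨e₁, hmem.2 (Or.inl rfl), Or.inr ht₁.symm⟩, ?_, ?_⟩
  · ext p
    rw [mem_support, mem_support]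
    constructor
    · rintro ⟨r, hr, hp⟩
      rcases hmem.1 hr with rfl | rfl | ⟨-, hr⟩
      exacts [⟨e, he, hc₁ hp⟩, ⟨e, he, hc₂ hp⟩, ⟨r, hr, hp⟩]
    · rintro ⟨r, hr, hp⟩
      by_cases hre : r = e
      · subst hre
        rw [hu] at hp
        rcases hp with hp | hp
        exacts [⟨e₁, hmem.2 (Or.inl rfl), hp⟩, ⟨e₂, hmem.2 (Or.inr (Or.inl rfl)), hp⟩]
      · exact ⟨r, hmem.2 (Or.inr (Or.inr ⟨hre, hr⟩)), hp⟩
  · intro r hr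
    rcases hmem.1 hr with rfl | rfl | ⟨-, hr⟩
    exacts [⟨e, he, hc₁⟩, ⟨e, he, hc₂⟩, ⟨r, hr, subset_rfl⟩]
  · intro w hg hw
    refine hw.of_gauge hg
      (fun r A => if r = e₁ then 1 else if r = e₂ then A.val e else A.val r) ?_ ?_
    · intro r hrγ
      by_cases h1 : r = e₁
      · simpa [h1] using isHolFun_const 1
      by_cases h2 : r = e₂
      · simpa only [h1, h2, if_false, if_true, h2 ▸ h1] using isHolFun_val he
      · simpa only [h1, h2, if_false] using
          isHolFun_val (((hmem.1 hrγ).resolve_left h1).resolve_left h2).2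
    · intro A
      refine ⟨Function.update 1 x (A.val e₁), fun r hrγ => ?_⟩
      have hsx : e₁.source ≠ x := hs₁ ▸ (hr e he).1
      have htx : e₂.target ≠ x := ht₂ ▸ (hr e he).2
      by_cases h1 : r = e₁
      · subst h1
        simp [gauge, ht₁, hsx]
      by_cases h2 : r = e₂
      · subst h2
        simp [gauge, hs₂, htx, h1,
          A.concat e₁ r e (ht₁.trans hs₂.symm) (ht₁ ▸ hi) hu hs₁.symm ht₂.symm]
      · have h3 := hr r (((hmem.1 hrγ).resolve_left h1).resolve_left h2).2
        simp only [h1, h2, if_false]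
        exact gauge_val_of_ne (by simp [h3.1]) (by simp [h3.2])

/-- A graph can be subdivided so that finitely many prescribed points become vertices, and this
yields no new gauge-invariant functions. -/
theorem Graph.exists_subdivision [T2Space M] (G X : Type*) [Group G] [TopologicalSpace G]
    [TopologicalSpace X] (γ : Graph d M) (V : Finset M) (hV : (V : Set M) ⊆ γ.support) :
    ∃ γ' : Graph d M, γ'.support = γ.support ∧ γ.vertices ⊆ γ'.vertices ∧ V ⊆ γ'.vertices ∧
      (∀ e' ∈ γ'.edges, ∃ e ∈ γ.edges, e'.carrier ⊆ e.carrier) ∧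
      ∀ w : GenConn d M G → X, IsGaugeInv w → IsHolFun γ'.edges w → IsHolFun γ.edges w := by
  classical
  induction V using Finset.induction_on with
  | empty => exact ⟨γ, rfl, subset_rfl, by simp, fun e he => ⟨e, he, subset_rfl⟩, fun _ _ h => h⟩
  | insert x V _ ih =>
    rw [Finset.coe_insert, Set.insert_subset_iff] at hV
    obtain ⟨γ₁, hs, hv, hV₁, he, hw⟩ := ih hV.2
    obtain ⟨γ₂, hs', hv', hx, he', hw'⟩ :=
      γ₁.exists_subdivision_singleton G X (x := x) (hs ▸ hV.1)
    refine ⟨γ₂, hs'.trans hs, hv.trans hv', Finset.insert_subset hx (hV₁.trans hv'), ?_,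
      fun w hg h => hw w hg (hw' w hg h)⟩
    intro r hr
    obtain ⟨r₁, hr₁, h₁⟩ := he' r hr
    obtain ⟨r₂, hr₂, h₂⟩ := he r₁ hr₁
    exact ⟨r₂, hr₂, h₁.trans h₂⟩

/-- The holonomy along an edge that has an end point of valence one can be gauged away. -/
theorem IsHolFun.erase_of_univalent {w : GenConn d M G → X} [DecidableEq (Edge d M)]
    (hw : IsHolFun E w) (hg : IsGaugeInv w) {s : Edge d M} {x : M} (hx : x = s.source ∨ x = s.target)
    (hE : ∀ r ∈ E, r ≠ s → x ∉ r.carrier) : IsHolFun (E.erase s) w := by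
  classical
  refine hw.of_gauge hg (fun r A => if r = s then 1 else A.val r) ?_ ?_
  · intro r hr
    by_cases h : r = s
    · simpa [h] using isHolFun_const 1
    · simpa only [h, if_false] using isHolFun_val (Finset.mem_erase.2 ⟨h, hr⟩)
  · intro A
    have key : ∀ a : G, ∀ r ∈ E, r ≠ s → (gauge (Function.update 1 x a) A).val r = A.val r := by
      intro a r hr hrs
      have h1 : r.source ≠ x := fun h => hE r hr hrs (h ▸ r.isArc.source_mem)
      have h2 : r.target ≠ x := fun h => hE r hr hrs (h ▸ r.isArc.target_mem)
      exact gauge_val_of_ne (by simp [h1]) (by simp [h2])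
    have hne := s.isArc.source_ne_target
    rcases hx with rfl | rfl
    · refine ⟨Function.update 1 s.source (A.val s)⁻¹, fun r hr => ?_⟩
      by_cases h : r = s
      · subst h
        simp [gauge, hne.symm]
      · simpa only [h, if_false] using key _ r hr h
    · refine ⟨Function.update 1 s.target (A.val s), fun r hr => ?_⟩
      by_cases h : r = s
      · subst h
        simp [gauge, hne]
      · simpa only [h, if_false] using key _ r hr h

end Functions

/-! ### Intersections of piecewise analytic arcs -/

section LocallyDecided

open scoped Topology
open Filter

/-- Within `I`, the predicate `P` is constant near `t`. -/
def IsLocallyDecided {X : Type*} [TopologicalSpace X] (I : Set X) (P : X → Prop) (t : X) : Prop :=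
  (∀ᶠ u in 𝓝[I] t, P u) ∨ ∀ᶠ u in 𝓝[I] t, ¬ P u

variable {X : Type*} [TopologicalSpace X] {I J : Set X} {P Q : X → Prop} {t : X}

theorem IsLocallyDecided.and (hP : IsLocallyDecided I P t) (hQ : IsLocallyDecided I Q t) :
    IsLocallyDecided I (fun u => P u ∧ Q u) t := by
  rcases hP with hP | hP
  · rcases hQ with hQ | hQ
    · exact Or.inl (hP.and hQ)
    · exact Or.inr (hQ.mono fun u hu h => hu h.2)
  · exact Or.inr (hP.mono fun u hu h => hu h.1)

theorem IsLocallyDecided.mono (hP : IsLocallyDecided I P t) (hJ : J ⊆ I) :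
    IsLocallyDecided J P t :=
  hP.imp (fun h => h.filter_mono (nhdsWithin_mono _ hJ)) fun h => h.filter_mono (nhdsWithin_mono _ hJ)

theorem IsLocallyDecided.congr (hP : IsLocallyDecided I P t) (h : ∀ᶠ u in 𝓝[I] t, Q u ↔ P u) :
    IsLocallyDecided I Q t := by
  refine hP.imp (fun hP => ?_) fun hP => ?_
  · filter_upwards [h, hP] with u hu hPu using hu.2 hPu
  · filter_upwards [h, hP] with u hu hPu hQ using hPu (hu.1 hQ)

theorem finite_not_isLocallyDecided (hI : IsCompact I)
    (h : ∀ t₀ ∈ I, ∀ᶠ t in 𝓝[I] t₀, t ≠ t₀ → IsLocallyDecided I P t) :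
    {t ∈ I | ¬ IsLocallyDecided I P t}.Finite := by
  have key : ({t | ¬ IsLocallyDecided I P t} ∩ I).Finite := by
    refine hI.induction_on (p := fun A => ({t | ¬ IsLocallyDecided I P t} ∩ A).Finite)
      (by simp) (fun A B hAB hB => hB.subset (Set.inter_subset_inter_right _ hAB))
      (fun A B hA hB => by rw [Set.inter_union_distrib_left]; exact hA.union hB) ?_
    intro t₀ ht₀
    refine ⟨_, h t₀ ht₀, (Set.finite_singleton t₀).subset ?_⟩
    rintro t ⟨ht, ht'⟩
    by_contra hne
    exact ht (ht' hne)
  exact key.subset fun t ht => ⟨ht.2, ht.1⟩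

theorem IsPreconnected.forall_or_forall_not (hJ : IsPreconnected J)
    (h : ∀ t ∈ J, IsLocallyDecided J P t) : (∀ t ∈ J, P t) ∨ ∀ t ∈ J, ¬ P t := by
  let U : Set X := {t | ∀ᶠ u in 𝓝 t, u ∈ J → P u}
  let V : Set X := {t | ∀ᶠ u in 𝓝 t, u ∈ J → ¬ P u}
  have hU : IsOpen U := isOpen_setOfPred_eventually_nhds
  have hV : IsOpen V := isOpen_setOfPred_eventually_nhds
  have hUV : J ⊆ U ∪ V := fun t ht => by
    rcases h t ht with h | h
    exacts [Or.inl (eventually_nhdsWithin_iff.1 h), Or.inr (eventually_nhdsWithin_iff.1 h)]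
  have hd : J ∩ (U ∩ V) = ∅ := Set.eq_empty_of_forall_notMem
    fun t ht => (ht.2.2.self_of_nhds ht.1) (ht.2.1.self_of_nhds ht.1)
  rcases isPreconnected_iff_subset_of_disjoint.1 hJ U V hU hV hUV hd with h | h
  · exact Or.inl fun t ht => (h ht).self_of_nhds ht
  · exact Or.inr fun t ht => (h ht).self_of_nhds ht

end LocallyDecided

section Analytic

open scoped Topology
open Filter

theorem isLocallyDecided_nonneg {h : ℝ → ℝ} {t₀ : ℝ} (hh : AnalyticAt ℝ h t₀) :
    ∀ᶠ t in 𝓝[≠] t₀, IsLocallyDecided Set.univ (fun u => 0 ≤ h u) t := by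
  rcases hh.eventually_eq_zero_or_eventually_ne_zero with h0 | h0
  · filter_upwards [h0.eventually_nhds.filter_mono nhdsWithin_le_nhds] with t ht
    left
    rw [nhdsWithin_univ]
    filter_upwards [ht] with u hu using hu.ge
  · filter_upwards [h0, hh.eventually_continuousAt.filter_mono nhdsWithin_le_nhds] with t ht hc
    rw [IsLocallyDecided, nhdsWithin_univ]
    rcases lt_or_gt_of_ne ht with hlt | hlt
    · right
      filter_upwards [hc.eventually_lt_const hlt] with u hu using not_le.2 hu
    · left
      filter_upwards [hc.eventually_const_lt hlt] with u hu using hu.le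

theorem isLocallyDecided_eq_zero {E : Type*} [NormedAddCommGroup E] [NormedSpace ℝ E]
    {h : ℝ → E} {t₀ : ℝ} (hh : AnalyticAt ℝ h t₀) :
    ∀ᶠ t in 𝓝[≠] t₀, IsLocallyDecided Set.univ (fun u => h u = 0) t := by
  rcases hh.eventually_eq_zero_or_eventually_ne_zero with h0 | h0
  · filter_upwards [h0.eventually_nhds.filter_mono nhdsWithin_le_nhds] with t ht
    left
    rwa [nhdsWithin_univ]
  · filter_upwards [h0, hh.eventually_continuousAt.filter_mono nhdsWithin_le_nhds] with t ht hc
    right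
    rw [nhdsWithin_univ]
    exact hc.eventually_ne ht

/-- Where two analytic curves meet and the second one is immersed, the parameter of the second
curve at an intersection point is an analytic function of the parameter of the first one. -/
theorem exists_analyticAt_parameter {E : Type*} [NormedAddCommGroup E] [InnerProductSpace ℝ E]
    {g g' : ℝ → E} {t₀ s₀ : ℝ} (hg : AnalyticAt ℝ g t₀) (hg' : AnalyticAt ℝ g' s₀)
    (hd : deriv g' s₀ ≠ 0) (h0 : g t₀ = g' s₀) :
    ∃ σ : ℝ → ℝ, AnalyticAt ℝ σ t₀ ∧ σ t₀ = s₀ ∧ ∀ᶠ s in 𝓝 s₀, ∀ t, g t = g' s → s = σ t := by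
  -- Project to the direction of the velocity of the second curve.
  set ℓ : E →L[ℝ] ℝ := innerSL ℝ (deriv g' s₀) with hℓ
  have hk : AnalyticAt ℝ (fun s => ℓ (g' s)) s₀ := ℓ.analyticAt _ |>.comp hg'
  have hkd : deriv (fun s => ℓ (g' s)) s₀ ≠ 0 := by
    have h : HasDerivAt (fun s => ℓ (g' s)) (ℓ (deriv g' s₀)) s₀ :=
      ℓ.hasFDerivAt.comp_hasDerivAt s₀ hg'.differentiableAt.hasDerivAt
    rw [h.deriv, hℓ, innerSL_apply_apply, real_inner_self_eq_norm_sq]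
    exact pow_ne_zero _ (norm_ne_zero_iff.2 hd)
  set r := hk.hasStrictDerivAt.localInverse _ _ _ hkd with hr
  have hra : AnalyticAt ℝ r (ℓ (g' s₀)) := hk.analyticAt_localInverse hkd
  have hrl : ∀ᶠ s in 𝓝 s₀, r (ℓ (g' s)) = s :=
    HasStrictDerivAt.eventually_left_inverse hk.hasStrictDerivAt hkd
  refine ⟨fun t => r (ℓ (g t)), ?_, ?_, ?_⟩
  · have : AnalyticAt ℝ (fun t => ℓ (g t)) t₀ := ℓ.analyticAt _ |>.comp hg
    rw [← h0] at hra
    exact AnalyticAt.comp (f := fun t => ℓ (g t)) hra this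
  · simp only [h0]
    exact hrl.self_of_nhds
  · filter_upwards [hrl] with s hs t ht
    simp only [ht, hs]

end Analytic

section Intersections

open scoped Topology
open Filter

variable {d : ℕ} {M : Type*} [TopologicalSpace M] [ChartedSpace (EuclideanSpace ℝ (Fin d)) M]

/-- In the chart at one of its points, an analytic curve extends analytically beyond its interval of
definition. -/
theorem exists_analyticAt_chart {a b t₀ : ℝ} {c : ℝ → M} (hab : a < b)
    (hc : ContMDiffOn 𝓘(ℝ, ℝ) (𝓡 d) ω c (Set.Icc a b)) (ht₀ : t₀ ∈ Set.Icc a b)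
    (hd : mfderivWithin 𝓘(ℝ, ℝ) (𝓡 d) c (Set.Icc a b) t₀ ≠ 0) :
    ∃ g : ℝ → EuclideanSpace ℝ (Fin d), AnalyticAt ℝ g t₀ ∧ deriv g t₀ ≠ 0 ∧
      ∀ t ∈ Set.Icc a b, extChartAt (𝓡 d) (c t₀) (c t) = g t := by
  have h := (contMDiffWithinAt_iff_target.1 (hc t₀ ht₀)).2
  rw [contMDiffWithinAt_iff_contDiffWithinAt] at h
  obtain ⟨g, hg0, hg, hga⟩ := h.analyticWithinAt.exists_analyticAt
  rw [Set.insert_eq_of_mem ht₀] at hg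
  refine ⟨g, hga, fun h0 => hd ?_, hg⟩
  have hu := uniqueDiffOn_Icc hab t₀ ht₀
  have hm : MDifferentiableWithinAt 𝓘(ℝ, ℝ) (𝓡 d) c (Set.Icc a b) t₀ :=
    (hc t₀ ht₀).mdifferentiableWithinAt (by simp)
  rw [hm.mfderivWithin]
  have h1 : fderivWithin ℝ (extChartAt (𝓡 d) (c t₀) ∘ c) (Set.Icc a b) t₀ = 0 := by
    rw [fderivWithin_congr hg hg0, hga.differentiableAt.fderivWithin hu]
    exact ContinuousLinearMap.ext_ring (by simpa using h0)
  simp only [mfld_simps] at h1 ⊢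
  exact h1

variable [T2Space M]

/-- If two points of an embedded curve are mapped close to each other, then their parameters are
close. -/
theorem eventually_mem_of_eq {X : Type*} [TopologicalSpace X] {I : Set X} {t₀ : X} {c : X → M}
    (hc : ContinuousWithinAt c I t₀) {a' b' s₀ : ℝ} {c' : ℝ → M}
    (hc' : ContinuousOn c' (Set.Icc a' b')) (hinj : Set.InjOn c' (Set.Icc a' b'))
    (hs₀ : s₀ ∈ Set.Icc a' b') (h0 : c t₀ = c' s₀) {W : Set ℝ} (hW : W ∈ 𝓝 s₀) :
    ∀ᶠ t in 𝓝[I] t₀, ∀ s ∈ Set.Icc a' b', c t = c' s → s ∈ W := by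
  obtain ⟨O, hOW, hO, hsO⟩ := mem_nhds_iff.1 hW
  have hK : IsClosed (c' '' (Set.Icc a' b' \ O)) :=
    ((isCompact_Icc.diff hO).image_of_continuousOn (hc'.mono Set.sdiff_subset)).isClosed
  have hp : c t₀ ∉ c' '' (Set.Icc a' b' \ O) := by
    rintro ⟨s, hs, hs'⟩
    exact hs.2 (hinj hs₀ hs.1 (h0.symm.trans hs'.symm) ▸ hsO)
  filter_upwards [hc (hK.isOpen_compl.mem_nhds hp)] with t ht s hs hts
  by_contra hsW
  exact ht ⟨s, ⟨hs, fun h => hsW (hOW h)⟩, hts.symm⟩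

/-- Apart from `t₀` itself, membership of an analytic curve in an analytic arc is locally constant
near `t₀`. -/
theorem eventually_isLocallyDecided {a b a' b' t₀ : ℝ} {c c' : ℝ → M} (hab : a < b)
    (hc : ContMDiffOn 𝓘(ℝ, ℝ) (𝓡 d) ω c (Set.Icc a b))
    (hd : ∀ t ∈ Set.Icc a b, mfderivWithin 𝓘(ℝ, ℝ) (𝓡 d) c (Set.Icc a b) t ≠ 0) (hab' : a' < b')
    (hc' : ContMDiffOn 𝓘(ℝ, ℝ) (𝓡 d) ω c' (Set.Icc a' b')) (hinj' : Set.InjOn c' (Set.Icc a' b'))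
    (hd' : ∀ t ∈ Set.Icc a' b', mfderivWithin 𝓘(ℝ, ℝ) (𝓡 d) c' (Set.Icc a' b') t ≠ 0)
    (ht₀ : t₀ ∈ Set.Icc a b) :
    ∀ᶠ t in 𝓝[Set.Icc a b] t₀, t ≠ t₀ →
      IsLocallyDecided (Set.Icc a b) (fun u => c u ∈ c' '' Set.Icc a' b') t := by
  have hK : IsClosed (c' '' Set.Icc a' b') :=
    (isCompact_Icc.image_of_continuousOn hc'.continuousOn).isClosed
  by_cases hmem : c t₀ ∈ c' '' Set.Icc a' b'
  swap
  · have h := hc.continuousOn t₀ ht₀ (hK.isOpen_compl.mem_nhds hmem)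
    filter_upwards [eventually_eventually_nhdsWithin.2 h] with t ht _ using Or.inr ht
  obtain ⟨s₀, hs₀, h0⟩ := hmem
  obtain ⟨g, hg, -, hcg⟩ := exists_analyticAt_chart hab hc ht₀ (hd t₀ ht₀)
  obtain ⟨g', hg', hgd', hcg'⟩ := exists_analyticAt_chart hab' hc' hs₀ (hd' s₀ hs₀)
  rw [h0] at hcg'
  obtain ⟨σ, hσ, hσ0, hσu⟩ := exists_analyticAt_parameter hg hg' hgd'
    ((hcg t₀ ht₀).symm.trans (h0 ▸ hcg' s₀ hs₀))
  -- Near `t₀`, the curve `c` meets the arc exactly where `c t = c' (σ t)` and `σ t ∈ [a', b']`.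
  have hiff : ∀ᶠ t in 𝓝[Set.Icc a b] t₀, c t ∈ c' '' Set.Icc a' b' ↔
      (g t - g' (σ t) = 0 ∧ 0 ≤ σ t - a') ∧ 0 ≤ b' - σ t := by
    have hsrc := extChartAt_source_mem_nhds (I := 𝓡 d) (c t₀)
    have h1 := eventually_mem_of_eq (hc.continuousOn t₀ ht₀) hc'.continuousOn hinj' hs₀ h0.symm hσu
    have h2 := hc.continuousOn t₀ ht₀ hsrc
    have h3 : ∀ᶠ s in 𝓝 s₀, s ∈ Set.Icc a' b' → c' s ∈ (extChartAt (𝓡 d) (c t₀)).source :=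
      eventually_nhdsWithin_iff.1 (hc'.continuousOn s₀ hs₀ (h0 ▸ hsrc))
    have h4 : ∀ᶠ t in 𝓝[Set.Icc a b] t₀, σ t ∈ Set.Icc a' b' →
        c' (σ t) ∈ (extChartAt (𝓡 d) (c t₀)).source := by
      have := hσ.continuousAt.tendsto
      rw [hσ0] at this
      exact (this.eventually h3).filter_mono nhdsWithin_le_nhds
    filter_upwards [h1, h2, h4, self_mem_nhdsWithin] with t h1 h2 h4 ht
    constructor
    · rintro ⟨s, hs, hst⟩
      have hgs : g t = g' s := by rw [← hcg t ht, ← hcg' s hs, hst]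
      obtain rfl : s = σ t := h1 s hs hst.symm t hgs
      exact ⟨⟨sub_eq_zero.2 hgs, sub_nonneg.2 hs.1⟩, sub_nonneg.2 hs.2⟩
    · rintro ⟨⟨he, h5⟩, h6⟩
      have hs : σ t ∈ Set.Icc a' b' := ⟨sub_nonneg.1 h5, sub_nonneg.1 h6⟩
      refine ⟨σ t, hs, (extChartAt (𝓡 d) (c t₀)).injOn (h4 hs) h2 ?_⟩
      rw [hcg t ht, hcg' _ hs]
      exact (sub_eq_zero.1 he).symm
  have hdec : ∀ᶠ t in 𝓝[≠] t₀, IsLocallyDecided Set.univ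
      (fun t => (g t - g' (σ t) = 0 ∧ 0 ≤ σ t - a') ∧ 0 ≤ b' - σ t) t := by
    have hgσ : AnalyticAt ℝ (fun t => g t - g' (σ t)) t₀ :=
      hg.sub (AnalyticAt.comp (f := σ) (hσ0.symm ▸ hg') hσ)
    filter_upwards [isLocallyDecided_eq_zero hgσ,
      isLocallyDecided_nonneg (hσ.sub analyticAt_const),
      isLocallyDecided_nonneg (analyticAt_const.sub hσ)] with t h1 h2 h3
    exact (h1.and h2).and h3
  have hdec' := (eventually_nhdsWithin_iff.1 hdec).filter_mono
    (nhdsWithin_le_nhds (s := Set.Icc a b))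
  filter_upwards [eventually_eventually_nhdsWithin.2 hiff, hdec'] with t h1 h2 hne
  exact ((h2 hne).mono (Set.subset_univ _)).congr h1

/-- Off finitely many points, connected parts of `S` lie either inside or outside of `K`. -/
def IsFinitelyCut (S K : Set M) : Prop :=
  ∃ V : Set M, V.Finite ∧ V ⊆ S ∧ ∀ J, IsPreconnected J → J ⊆ S → Disjoint J V →
    J ⊆ K ∨ Disjoint J K

omit [ChartedSpace (EuclideanSpace ℝ (Fin d)) M] [T2Space M] in
theorem IsFinitelyCut.union {S K L : Set M} (h₁ : IsFinitelyCut S K) (h₂ : IsFinitelyCut S L) :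
    IsFinitelyCut S (K ∪ L) := by
  obtain ⟨V, hV, hVS, h₁⟩ := h₁
  obtain ⟨W, hW, hWS, h₂⟩ := h₂
  refine ⟨V ∪ W, hV.union hW, Set.union_subset hVS hWS, fun J hJ hJS hd => ?_⟩
  rw [Set.disjoint_union_right] at hd
  rcases h₁ J hJ hJS hd.1 with h | h
  · exact Or.inl (h.trans Set.subset_union_left)
  rcases h₂ J hJ hJS hd.2 with h' | h'
  · exact Or.inl (h'.trans Set.subset_union_right)
  · exact Or.inr (Set.disjoint_union_right.2 ⟨h, h'⟩)

theorem IsAnalyticArc.isFinitelyCut {S K : Set M} {x y x' y' : M} (hS : IsAnalyticArc d S x y)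
    (hK : IsAnalyticArc d K x' y') : IsFinitelyCut S K := by
  obtain ⟨a, b, c, hab, hc, hinj, hd, rfl, rfl, rfl⟩ := hS
  obtain ⟨a', b', c', hab', hc', hinj', hd', rfl, rfl, rfl⟩ := hK
  set P : ℝ → Prop := fun u => c u ∈ c' '' Set.Icc a' b' with hP
  have hfin := finite_not_isLocallyDecided isCompact_Icc fun t₀ ht₀ =>
    eventually_isLocallyDecided hab hc hd hab' hc' hinj' hd' ht₀
  refine ⟨_, hfin.image c, Set.image_mono (Set.sep_subset _ _), fun J hJ hJS hJd => ?_⟩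
  -- Pull back to the parameter interval, which is homeomorphic to the arc.
  let f : Set.Icc a b → M := fun t => c t
  have hf : Continuous f := continuousOn_iff_continuous_domRestrict.1 hc.continuousOn
  have hfi : Function.Injective f := fun s t h => Subtype.ext (hinj s.2 t.2 h)
  have hpre : IsPreconnected (Subtype.val '' (f ⁻¹' J)) :=
    (hJ.preimage_of_isClosedMap hfi hf.isClosedMap (by
      intro p hp
      obtain ⟨t, ht, rfl⟩ := hJS hp
      exact ⟨⟨t, ht⟩, rfl⟩)).image _ continuous_subtype_val.continuousOn
  have hsub : Subtype.val '' (f ⁻¹' J) ⊆ Set.Icc a b := by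
    rintro _ ⟨t, -, rfl⟩
    exact t.2
  have hdec : ∀ t ∈ Subtype.val '' (f ⁻¹' J), IsLocallyDecided (Subtype.val '' (f ⁻¹' J)) P t := by
    rintro _ ⟨t, ht, rfl⟩
    by_contra hn
    refine Set.disjoint_left.1 hJd ht ⟨t, ⟨t.2, fun h => hn (h.mono hsub)⟩, rfl⟩
  rcases IsPreconnected.forall_or_forall_not hpre hdec with h | h
  · left
    intro p hp
    obtain ⟨t, ht, rfl⟩ := hJS hp
    exact h t ⟨⟨t, ht⟩, hp, rfl⟩
  · right
    refine Set.disjoint_left.2 fun p hp => ?_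
    obtain ⟨t, ht, rfl⟩ := hJS hp
    exact h t ⟨⟨t, ht⟩, hp, rfl⟩

theorem IsArc.isFinitelyCut {S K : Set M} {x y x' y' : M} (hS : IsArc d S x y)
    (hK : IsArc d K x' y') : IsFinitelyCut S K := by
  induction hS with
  | analytic hS =>
    induction hK with
    | analytic hK => exact hS.isFinitelyCut hK
    | concat _ _ _ ih₁ ih₂ => exact ih₁.union ih₂
  | @concat S T x y z hS hT hST ih₁ ih₂ =>
    obtain ⟨V, hV, hVS, h₁⟩ := ih₁
    obtain ⟨W, hW, hWS, h₂⟩ := ih₂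
    refine ⟨V ∪ W ∪ {y}, (hV.union hW).union (Set.finite_singleton y), ?_, fun J hJ hJS hd => ?_⟩
    · rintro p ((hp | hp) | rfl)
      exacts [Or.inl (hVS hp), Or.inr (hWS hp), Or.inl hS.target_mem]
    rw [Set.disjoint_union_right, Set.disjoint_union_right, Set.disjoint_singleton_right] at hd
    have hdj : J ∩ (S ∩ T) = ∅ := by
      rw [hST]
      exact Set.inter_singleton_eq_empty.2 hd.2
    rcases isPreconnected_iff_subset_of_disjoint_closed.1 hJ S T hS.isClosed hT.isClosed hJS hdj
      with h | h
    · exact h₁ J hJ h hd.1.1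
    · exact h₂ J hJ h hd.1.2

theorem Edge.isFinitelyCut_support (e : Edge d M) (γ : Graph d M) :
    IsFinitelyCut e.carrier γ.support := by
  classical
  have : ∀ E : Finset (Edge d M), IsFinitelyCut e.carrier (⋃ e' ∈ E, e'.carrier) := by
    intro E
    induction E using Finset.induction_on with
    | empty => exact ⟨∅, Set.finite_empty, Set.empty_subset _, fun J _ _ _ => Or.inr (by simp)⟩
    | insert e' E _ ih =>
      rw [Finset.set_biUnion_insert]
      exact (e.isArc.isFinitelyCut e'.isArc).union ih
  exact this _

/-- A graph can be cut at finitely many points into pieces that lie inside or outside of a second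
graph. -/
theorem Graph.isFinitelyCut_support (γ β : Graph d M) : IsFinitelyCut γ.support β.support := by
  choose V hV hVs h using fun e : Edge d M => e.isFinitelyCut_support β
  refine ⟨(⋃ e ∈ γ.edges, V e) ∪ γ.vertices,
    (γ.edges.finite_toSet.biUnion fun e _ => hV e).union γ.vertices.finite_toSet, ?_,
    fun J hJ hJS hd => ?_⟩
  · refine Set.union_subset (Set.iUnion₂_subset fun e he => ?_) γ.vertices_subset_support
    exact (hVs e).trans (carrier_subset_support he)
  · rw [Set.disjoint_union_right] at hd
    rcases J.eq_empty_or_nonempty with rfl | hne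
    · exact Or.inl (Set.empty_subset _)
    obtain ⟨e, he, hJe⟩ := exists_edge_of_isPreconnected hJ hne hJS
      fun x hx => Set.disjoint_left.1 hd.2 hx
    exact h e J hJ hJe (hd.1.mono_right (Set.subset_biUnion_of_mem (u := V) he))

end Intersections

/-! ### The Haar measure of the structure group -/

section Haar

variable {G : Type*} [Group G] [TopologicalSpace G] [IsTopologicalGroup G] [CompactSpace G]
  [MeasurableSpace G] [BorelSpace G]

instance : (haarProb G).IsHaarMeasure := by
  unfold haarProb
  infer_instance

instance : IsProbabilityMeasure (haarProb G) :=
  ⟨by simpa [haarProb] using Measure.haarMeasure_self (G := G) (K₀ := ⊤)⟩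

theorem integral_haarProb_mul_mul (f : G → ℂ) (a b : G) :
    ∫ h, f (a * h * b) ∂haarProb G = ∫ h, f h ∂haarProb G := by
  have hr : (haarProb G).map (fun h => h * b) = haarProb G := by
    have h1 : ((haarProb G).map fun h => MulOpposite.op b • h).IsHaarMeasure :=
      Measure.isHaarMeasure_map_smul _ _
    have h2 : IsProbabilityMeasure ((haarProb G).map fun h => MulOpposite.op b • h) :=
      Measure.isProbabilityMeasure_map (by fun_prop)
    exact Measure.isHaarMeasure_eq_of_isProbabilityMeasure
      ((haarProb G).map fun h => MulOpposite.op b • h) _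
  calc ∫ h, f (a * h * b) ∂haarProb G = ∫ h, f (h * b) ∂haarProb G :=
        integral_mul_left_eq_self (fun h => f (h * b)) a
    _ = ∫ h, f h ∂(haarProb G).map (fun h => h * b) :=
        ((Homeomorph.mulRight b).measurableEmbedding.integral_map f).symm
    _ = ∫ h, f h ∂haarProb G := by rw [hr]

end Haar

/-! ### Cylindrical functions -/

section Cylindrical

variable {d : ℕ} {M : Type*} [TopologicalSpace M] [ChartedSpace (EuclideanSpace ℝ (Fin d)) M]
  {G : Type*} [Group G] [TopologicalSpace G] [IsTopologicalGroup G] [CompactSpace G]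
  [MeasurableSpace G] [BorelSpace G] {μ : Measure (GenConn d M G)}

omit [IsTopologicalGroup G] [CompactSpace G] [BorelSpace G] in
theorem mem_Cyl {γ : Graph d M} {ψ : HAL μ} :
    ψ ∈ Cyl μ γ ↔
      ∃ u : GenConn d M G → ℂ, IsHolFun γ.edges u ∧ IsGaugeInv u ∧ ψ =ᵐ[μ] u := by
  constructor
  · rintro ⟨F, hF, hg, hψ⟩
    exact ⟨_, ⟨F, hF, fun _ => rfl⟩, hg, hψ⟩
  · rintro ⟨u, ⟨F, hF, hu⟩, hg, hψ⟩
    obtain rfl : u = fun A => F (hol γ.edges A) := funext hu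
    exact ⟨F, hF, hg, hψ⟩

omit [IsTopologicalGroup G] [CompactSpace G] [BorelSpace G] in
theorem Cyl_mono {γ γ' : Graph d M} (h : ∀ u : GenConn d M G → ℂ, IsGaugeInv u →
    IsHolFun γ.edges u → IsHolFun γ'.edges u) : Cyl μ γ ≤ Cyl μ γ' := by
  intro ψ hψ
  obtain ⟨u, hu, hg, hψ⟩ := mem_Cyl.1 hψ
  exact mem_Cyl.2 ⟨u, h u hg hu, hg, hψ⟩

theorem Cyl_mono_of_edges_subset {γ γ' : Graph d M} (h : γ.edges ⊆ γ'.edges) :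
    Cyl μ γ ≤ Cyl μ γ' := Cyl_mono fun _ _ hu => hu.mono h

theorem Cyl_le_of_support_subset [T2Space M] {γ γ' : Graph d M} (hs : γ.support ⊆ γ'.support)
    (hv : γ.vertices ⊆ γ'.vertices) : Cyl μ γ ≤ Cyl μ γ' :=
  Cyl_mono fun _ _ hu => hu.trans fun e he => γ'.isHolFun_val_of_subset e
    ((Graph.carrier_subset_support he).trans hs) (hv (Graph.source_mem_vertices he))
    (hv (Graph.target_mem_vertices he))

/-- The gauge-invariant cylindrical functions depend on the point set of a graph only. -/
theorem Cyl_le_of_support_eq [T2Space M] {γ γ' : Graph d M} (h : γ.support = γ'.support) :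
    Cyl μ γ ≤ Cyl μ γ' := by
  obtain ⟨Γ, hs, -, hv, -, hw⟩ :=
    γ'.exists_subdivision G ℂ γ.vertices (h ▸ γ.vertices_subset_support)
  exact (Cyl_le_of_support_subset (h.trans hs.symm).subset hv).trans (Cyl_mono hw)

omit [IsTopologicalGroup G] [CompactSpace G] [BorelSpace G] in
theorem Hgr_mono {γ γ' : Graph d M} (h : Cyl μ γ ≤ Cyl μ γ') : Hgr μ γ ≤ Hgr μ γ' :=
  Submodule.topologicalClosure_mono h

omit [TopologicalSpace G] [IsTopologicalGroup G] [CompactSpace G] [BorelSpace G] in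
theorem measurable_hol (E : Finset (Edge d M)) : Measurable (hol (G := G) E) :=
  measurable_pi_lambda _ fun e => (measurable_pi_apply e.1).comp (comap_measurable GenConn.val)

omit [TopologicalSpace G] [IsTopologicalGroup G] [CompactSpace G] [BorelSpace G] in
theorem measurable_val (e : Edge d M) : Measurable fun A : GenConn d M G => A.val e :=
  (measurable_pi_apply e).comp (comap_measurable GenConn.val)

omit [IsTopologicalGroup G] in
theorem IsHolFun.memLp [SecondCountableTopology G] [IsFiniteMeasure μ] {E : Finset (Edge d M)}
    {u : GenConn d M G → ℂ} (hu : IsHolFun E u) : MemLp u 2 μ := by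
  obtain ⟨F, hF, hu⟩ := hu
  obtain rfl : u = fun A => F (hol E A) := funext hu
  obtain ⟨C, hC⟩ := (isCompact_range hF).isBounded.exists_norm_le
  exact MemLp.of_bound (hF.measurable.comp (measurable_hol E)).aestronglyMeasurable C
    (Filter.Eventually.of_forall fun A => hC _ ⟨_, rfl⟩)

end Cylindrical

/-! ### Integration over single holonomies -/

section Integration

variable {d : ℕ} {M : Type*} [TopologicalSpace M] [ChartedSpace (EuclideanSpace ℝ (Fin d)) M]
  {G : Type*} [Group G] [TopologicalSpace G] [IsTopologicalGroup G] [CompactSpace G]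
  [SecondCountableTopology G] [MeasurableSpace G] [BorelSpace G] {μ : Measure (GenConn d M G)}

open scoped Classical in
/-- The family of holonomies along the edges in `E'` that consists of the holonomies `p.2` along the
edges in `E` and the holonomy `p.1` along all other edges. It is used if there is at most one of the
latter. -/
noncomputable def insertHol (E E' : Finset (Edge d M)) (p : G × (E → G)) : E' → G :=
  fun e => if h : e.1 ∈ E then p.2 ⟨e, h⟩ else p.1

omit [Group G] [IsTopologicalGroup G] [CompactSpace G] [SecondCountableTopology G]
  [MeasurableSpace G] [BorelSpace G] in
theorem continuous_insertHol (E E' : Finset (Edge d M)) :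
    Continuous (insertHol (G := G) E E') := by
  classical
  refine continuous_pi fun e => ?_
  by_cases h : e.1 ∈ E
  · simp only [insertHol, h, dif_pos]
    fun_prop
  · simp only [insertHol, h, dif_neg, not_false_eq_true]
    fun_prop

omit [TopologicalSpace G] [IsTopologicalGroup G] [CompactSpace G] [SecondCountableTopology G]
  [MeasurableSpace G] [BorelSpace G] in
theorem insertHol_hol {s : Edge d M} {E E' : Finset (Edge d M)}
    (h : ∀ e ∈ E', e ∈ E ∨ e = s) (A : GenConn d M G) :
    insertHol E E' (A.val s, hol E A) = hol E' A := by
  classical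
  funext e
  by_cases he : e.1 ∈ E
  · simp [insertHol, he, hol]
  · simp [insertHol, hol, (h e e.2).resolve_left he]

namespace IsAshtekarLewandowski

variable (hμ : IsAshtekarLewandowski μ)

include hμ

/-- The joint law of the holonomies along edges of a graph has full support. -/
theorem isOpenPosMeasure_map_hol (γ : Graph d M) (E : Finset (Edge d M)) (hE : E ⊆ γ.edges) :
    (μ.map (hol E)).IsOpenPosMeasure := by
  classical
  have := hμ.isProbabilityMeasure
  induction E using Finset.induction_on with
  | empty =>
    have := Measure.isProbabilityMeasure_map (μ := μ)
      (measurable_hol (G := G) (∅ : Finset (Edge d M))).aemeasurable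
    refine ⟨fun U _ hne => ?_⟩
    rw [Subsingleton.eq_univ_of_nonempty hne, measure_univ]
    exact one_ne_zero
  | insert s E hs ih =>
    rw [Finset.insert_subset_iff] at hE
    have := ih hE.2
    have hlaw := hμ.law s E fun e he =>
      (γ.disj e (hE.2 he) s hE.1 (by rintro rfl; exact hs he)).trans Set.inter_subset_right
    have := Measure.isProbabilityMeasure_map (μ := μ) (measurable_hol (G := G) E).aemeasurable
    have hm : Measurable fun A : GenConn d M G => (A.val s, hol E A) :=
      (measurable_val s).prodMk (measurable_hol E)
    have hpos : (μ.map fun A => (A.val s, hol E A)).IsOpenPosMeasure := by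
      rw [hlaw]
      infer_instance
    have heq : hol (G := G) (insert s E) =
        insertHol E (insert s E) ∘ fun A => (A.val s, hol E A) := by
      funext A
      exact (insertHol_hol (fun e he => (Finset.mem_insert.1 he).symm) A).symm
    rw [heq, ← Measure.map_map (continuous_insertHol _ _).measurable hm]
    refine (continuous_insertHol _ _).isOpenPosMeasure_map fun y =>
      ⟨(y ⟨s, Finset.mem_insert_self _ _⟩, fun e => y ⟨e, Finset.mem_insert_of_mem e.2⟩), ?_⟩
    funext e
    by_cases he : e.1 ∈ E
    · simp [insertHol, he]
    · have : e = ⟨s, Finset.mem_insert_self _ _⟩ :=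
        Subtype.ext ((Finset.mem_insert.1 e.2).resolve_right he)
      simp [insertHol, this]

/-- The law of the holonomies along the edges of a graph is the same for all measures that satisfy
the characterization of the Ashtekar-Lewandowski measure. -/
theorem map_hol_eq {ν : Measure (GenConn d M G)} (hν : IsAshtekarLewandowski ν)
    (γ : Graph d M) (E : Finset (Edge d M)) (hE : E ⊆ γ.edges) :
    μ.map (hol E) = ν.map (hol E) := by
  classical
  have := hμ.isProbabilityMeasure
  have := hν.isProbabilityMeasure
  induction E using Finset.induction_on with
  | empty =>
    have h := measurable_hol (G := G) (∅ : Finset (Edge d M))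
    have := Measure.isProbabilityMeasure_map (μ := μ) h.aemeasurable
    have := Measure.isProbabilityMeasure_map (μ := ν) h.aemeasurable
    ext U _
    rcases U.eq_empty_or_nonempty with rfl | hne
    · simp
    · rw [Subsingleton.eq_univ_of_nonempty hne, measure_univ, measure_univ]
  | insert s E hs ih =>
    rw [Finset.insert_subset_iff] at hE
    have hd : ∀ e ∈ E, e.carrier ∩ s.carrier ⊆ {s.source, s.target} := fun e he =>
      (γ.disj e (hE.2 he) s hE.1 (by rintro rfl; exact hs he)).trans Set.inter_subset_right
    have hm : Measurable fun A : GenConn d M G => (A.val s, hol E A) :=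
      (measurable_val s).prodMk (measurable_hol E)
    have heq : hol (G := G) (insert s E) =
        insertHol E (insert s E) ∘ fun A => (A.val s, hol E A) := by
      funext A
      exact (insertHol_hol (fun e he => (Finset.mem_insert.1 he).symm) A).symm
    rw [heq, ← Measure.map_map (continuous_insertHol _ _).measurable hm,
      ← Measure.map_map (continuous_insertHol _ _).measurable hm, hμ.law s E hd, hν.law s E hd,
      ih hE.2]

/-- Integrating out the holonomy along an edge `s` of a graph: a gauge-invariant cylindrical
function `u` may be replaced by a gauge-invariant function of the holonomies along the other edges,
without changing integrals against functions of holonomies along edges that meet `s` at most in its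
end points. -/
theorem exists_integrate_out [DecidableEq (Edge d M)] (γ : Graph d M) {E : Finset (Edge d M)}
    (hE : E ⊆ γ.edges) {s : Edge d M} (hs : s ∈ E) {u : GenConn d M G → ℂ} (hu : IsHolFun E u)
    (hg : IsGaugeInv u) :
    ∃ u' : GenConn d M G → ℂ, IsHolFun (E.erase s) u' ∧ IsGaugeInv u' ∧
      ∀ (E' : Finset (Edge d M)), (∀ e ∈ E', e.carrier ∩ s.carrier ⊆ {s.source, s.target}) →
        ∀ v : GenConn d M G → ℂ, IsHolFun E' v → ∫ A, v A * u A ∂μ = ∫ A, v A * u' A ∂μ := by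
  have := hμ.isProbabilityMeasure
  obtain ⟨F, hF, huF⟩ := hu
  set E₁ := E.erase s with hE₁
  have hE₁γ : E₁ ⊆ γ.edges := (Finset.erase_subset _ _).trans hE
  have hins : ∀ e ∈ E, e ∈ E₁ ∨ e = s := fun e he => by
    by_cases h : e = s
    exacts [Or.inr h, Or.inl (Finset.mem_erase.2 ⟨h, he⟩)]
  have hsd : ∀ e ∈ E₁, e.carrier ∩ s.carrier ⊆ {s.source, s.target} := fun e he =>
    (γ.disj e (hE₁γ he) s (hE hs) (Finset.ne_of_mem_erase he)).trans Set.inter_subset_right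
  set Φ : G × (E₁ → G) → ℂ := fun p => F (insertHol E₁ E p) with hΦ
  have hΦc : Continuous Φ := hF.comp (continuous_insertHol E₁ E)
  have huΦ : ∀ A, u A = Φ (A.val s, hol E₁ A) := fun A => by
    rw [huF, hΦ]
    simp only [insertHol_hol hins]
  -- By density, `Φ` is gauge invariant at all points, not only at holonomies of connections.
  have hΦg : ∀ (g : M → G) (h : G) (y : E₁ → G),
      Φ (g s.source * h * (g s.target)⁻¹, fun e => g e.1.source * y e * (g e.1.target)⁻¹)
        = Φ (h, y) := by
    intro g h y
    set Θ : G × (E₁ → G) → G × (E₁ → G) := fun p => (g s.source * p.1 * (g s.target)⁻¹,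
      fun e => g e.1.source * p.2 e * (g e.1.target)⁻¹) with hΘ
    have hΘc : Continuous Θ := by
      refine Continuous.prodMk (by fun_prop) (continuous_pi fun e => by fun_prop)
    have hdense : DenseRange fun A : GenConn d M G => (A.val s, hol E₁ A) := by
      have hm : Measurable fun A : GenConn d M G => (A.val s, hol E₁ A) :=
        (measurable_val s).prodMk (measurable_hol E₁)
      have := hμ.isOpenPosMeasure_map_hol γ E₁ hE₁γ
      have := Measure.isProbabilityMeasure_map (μ := μ) (measurable_hol (G := G) E₁).aemeasurable
      have hpos : (μ.map fun A => (A.val s, hol E₁ A)).IsOpenPosMeasure := by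
        rw [hμ.law s E₁ hsd]
        infer_instance
      refine dense_iff_inter_open.2 fun U hU hne => ?_
      have h0 := hU.measure_ne_zero (μ.map fun A => (A.val s, hol E₁ A)) hne
      rw [Measure.map_apply hm hU.measurableSet] at h0
      obtain ⟨A, hA⟩ := nonempty_of_measure_ne_zero h0
      exact ⟨_, hA, A, rfl⟩
    have heq : Φ ∘ Θ = Φ := hdense.equalizer (hΦc.comp hΘc) hΦc (funext fun A => by
      have := hg g A
      rw [huΦ, huΦ] at this
      exact this)
    exact congrFun heq (h, y)
  refine ⟨fun A => ∫ h, Φ (h, hol E₁ A) ∂haarProb G,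
    ⟨fun y => ∫ h, Φ (h, y) ∂haarProb G, ?_, fun _ => rfl⟩, fun g A => ?_, fun E' hE' v hv => ?_⟩
  · have := continuous_parametric_integral_of_continuous (μ := haarProb G)
      (f := fun (y : E₁ → G) h => Φ (h, y)) (by fun_prop) (isCompact_univ (X := G))
    simpa using this
  · have h1 : hol E₁ (gauge g A) = fun e => g e.1.source * hol E₁ A e * (g e.1.target)⁻¹ := rfl
    dsimp only
    rw [h1, ← integral_haarProb_mul_mul _ (g s.source) (g s.target)⁻¹]
    exact integral_congr_ae (Filter.Eventually.of_forall fun h => hΦg g h _)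
  · obtain ⟨K, hK, hvK⟩ := hv
    set E₂ := E₁ ∪ E' with hE₂
    have hlaw := hμ.law s E₂ fun e he => (Finset.mem_union.1 he).elim (hsd e) (hE' e)
    let r₁ : (E₂ → G) → E₁ → G := fun y e => y ⟨e, Finset.mem_union_left _ e.2⟩
    let r₂ : (E₂ → G) → E' → G := fun y e => y ⟨e, Finset.mem_union_right _ e.2⟩
    have hr₁ : Continuous r₁ := continuous_pi fun e => continuous_apply _
    have hr₂ : Continuous r₂ := continuous_pi fun e => continuous_apply _
    have := Measure.isProbabilityMeasure_map (μ := μ) (measurable_hol (G := G) E₂).aemeasurable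
    have hm : Measurable fun A : GenConn d M G => (A.val s, hol E₂ A) :=
      (measurable_val s).prodMk (measurable_hol E₂)
    have hΨc : Continuous fun p : G × (E₂ → G) => K (r₂ p.2) * Φ (p.1, r₁ p.2) := by fun_prop
    have hint : Integrable (fun p : G × (E₂ → G) => K (r₂ p.2) * Φ (p.1, r₁ p.2))
        ((haarProb G).prod (μ.map (hol E₂))) := by
      obtain ⟨C, hC⟩ := (isCompact_range hΨc).isBounded.exists_norm_le
      exact Integrable.of_bound hΨc.measurable.aestronglyMeasurable C
        (Filter.Eventually.of_forall fun A => hC _ ⟨_, rfl⟩)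
    have hcont : Continuous fun y : E₂ → G => K (r₂ y) * ∫ h, Φ (h, r₁ y) ∂haarProb G := by
      have := continuous_parametric_integral_of_continuous (μ := haarProb G)
        (f := fun (y : E₂ → G) h => Φ (h, r₁ y)) (by fun_prop) (isCompact_univ (X := G))
      simp only [Measure.restrict_univ] at this
      exact (hK.comp hr₂).mul this
    calc ∫ A, v A * u A ∂μ
        = ∫ A, (fun p : G × (E₂ → G) => K (r₂ p.2) * Φ (p.1, r₁ p.2)) (A.val s, hol E₂ A) ∂μ :=
          integral_congr_ae (Filter.Eventually.of_forall fun A => by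
            simp only [hvK, huΦ]; rfl)
      _ = ∫ p, K (r₂ p.2) * Φ (p.1, r₁ p.2) ∂((haarProb G).prod (μ.map (hol E₂))) := by
          rw [← hlaw, integral_map hm.aemeasurable hΨc.measurable.aestronglyMeasurable]
      _ = ∫ y, K (r₂ y) * ∫ h, Φ (h, r₁ y) ∂haarProb G ∂(μ.map (hol E₂)) := by
          rw [integral_prod_symm _ hint]
          simp only [integral_const_mul]
      _ = ∫ A, v A * ∫ h, Φ (h, hol E₁ A) ∂haarProb G ∂μ := by
          rw [integral_map (measurable_hol E₂).aemeasurable hcont.measurable.aestronglyMeasurable]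
          exact integral_congr_ae (Filter.Eventually.of_forall fun A => by
            simp only [hvK]; rfl)

/-- The Hilbert space version of integrating out a holonomy. -/
theorem exists_inner_eq_of_erase [DecidableEq (Edge d M)] (γ : Graph d M) {s : Edge d M}
    (hs : s ∈ γ.edges) {f : HAL μ} (hf : f ∈ Cyl μ γ) :
    ∃ f' ∈ Cyl μ (γ.subgraph (γ.edges.erase s)), ∀ β : Graph d M,
      (∀ e ∈ β.edges, e.carrier ∩ s.carrier ⊆ {s.source, s.target}) →
        ∀ ψ ∈ Hgr μ β, ⟪ψ, f⟫_ℂ = ⟪ψ, f'⟫_ℂ := by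
  have := hμ.isProbabilityMeasure
  obtain ⟨u, hu, hg, hfu⟩ := mem_Cyl.1 hf
  obtain ⟨u', hu', hg', h⟩ := hμ.exists_integrate_out γ subset_rfl hs hu hg
  have hf' := (hu'.memLp (μ := μ)).coeFn_toLp
  set f' : HAL μ := (hu'.memLp (μ := μ)).toLp u'
  refine ⟨f', mem_Cyl.2 ⟨u', hu'.mono fun e he => ?_, hg', hf'⟩, fun β hβ ψ hψ => ?_⟩
  · exact Graph.mem_edges_subgraph.2 ⟨Finset.mem_of_mem_erase he, he⟩
  · have hker : Cyl μ β ≤ (ℂ ∙ (f - f'))ᗮ := by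
      intro ψ hψ
      obtain ⟨v, hv, -, hψv⟩ := mem_Cyl.1 hψ
      rw [Submodule.mem_orthogonal_singleton_iff_inner_left, inner_sub_right, sub_eq_zero,
        L2.inner_def, L2.inner_def]
      have hv' : IsHolFun β.edges fun A => (starRingEnd ℂ) (v A) := by
        obtain ⟨K, hK, hvK⟩ := hv
        exact ⟨fun y => (starRingEnd ℂ) (K y), Complex.continuous_conj.comp hK,
          fun A => congrArg _ (hvK A)⟩
      calc ∫ A, ⟪ψ A, f A⟫_ℂ ∂μ = ∫ A, (starRingEnd ℂ) (v A) * u A ∂μ :=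
            integral_congr_ae (by
              filter_upwards [hψv, hfu] with A h1 h2
              rw [h1, h2, RCLike.inner_apply, mul_comm])
        _ = ∫ A, (starRingEnd ℂ) (v A) * u' A ∂μ := h β.edges hβ _ hv'
        _ = ∫ A, ⟪ψ A, f' A⟫_ℂ ∂μ := integral_congr_ae (by
              filter_upwards [hψv, hf'] with A h1 h2
              rw [h1, h2, RCLike.inner_apply, mul_comm])
    have := Submodule.topologicalClosure_minimal _ hker (Submodule.isClosed_orthogonal _) hψ
    rwa [Submodule.mem_orthogonal_singleton_iff_inner_left, inner_sub_right, sub_eq_zero] at this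

end IsAshtekarLewandowski

end Integration

/-! ### Orthogonality of the spaces of proper states -/

section Orthogonality

variable {d : ℕ} {M : Type*} [TopologicalSpace M] [ChartedSpace (EuclideanSpace ℝ (Fin d)) M]

/-- Two edges of a graph that share a vertex `x` do not leave `x` along the same arc `e`. -/
theorem Graph.not_subset_of_common_vertex [T2Space M] {Γ : Graph d M} {t t' e : Edge d M}
    (ht : t ∈ Γ.edges) (ht' : t' ∈ Γ.edges) (hne : t' ≠ t) {x : M} (hx : x ∈ Γ.vertices)
    (hxt : x ∈ t.carrier) (hxt' : x ∈ t'.carrier) (hxe : x = e.source ∨ x = e.target)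
    (hte : t.carrier ⊆ e.carrier) : ¬ t'.carrier ⊆ e.carrier := by
  intro hte'
  obtain ⟨y, hy, hyx, harc⟩ : ∃ y ∈ Γ.vertices, y ≠ x ∧
      (IsArc d t.carrier x y ∨ IsArc d t.carrier y x) := by
    rcases eq_or_eq_of_mem_vertices hx ht hxt with rfl | rfl
    · exact ⟨_, target_mem_vertices ht, t.isArc.source_ne_target.symm, Or.inl t.isArc⟩
    · exact ⟨_, source_mem_vertices ht, t.isArc.source_ne_target, Or.inr t.isArc⟩
  have hJ : t'.inner ⊆ t'.carrier \ {y} := fun p hp => ⟨hp.1, by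
    rintro rfl
    exact notMem_vertices_of_mem_inner ht' hp hy⟩
  have h := e.isArc.subset_of_initial hxe harc hte
    (t'.isArc.isPreconnected_of_diff_subset hJ Set.sdiff_subset) (Set.sdiff_subset.trans hte')
    ⟨hxt', hyx.symm⟩ (fun h => h.2 rfl)
  obtain ⟨p, hp⟩ := t'.inner_nonempty
  exact hne (eq_of_mem_inner ht' hp ht (h (hJ hp))).symm

/-- At most two edges of a subdivision meet in an interior point `x` of an edge `e`. -/
theorem Graph.false_of_three_edges [T2Space M] {Γ : Graph d M} {t₁ t₂ t₃ e : Edge d M} {x : M}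
    (hxe : x ∈ e.inner) (hx : x ∈ Γ.vertices)
    (h₁ : t₁ ∈ Γ.edges ∧ x ∈ t₁.carrier ∧ t₁.carrier ⊆ e.carrier)
    (h₂ : t₂ ∈ Γ.edges ∧ x ∈ t₂.carrier ∧ t₂.carrier ⊆ e.carrier)
    (h₃ : t₃ ∈ Γ.edges ∧ x ∈ t₃.carrier ∧ t₃.carrier ⊆ e.carrier)
    (h₁₂ : t₁ ≠ t₂) (h₁₃ : t₁ ≠ t₃) (h₂₃ : t₂ ≠ t₃) : False := by
  obtain ⟨e₁, e₂, -, ht₁, hs₂, -, hi, hu⟩ := e.exists_split hxe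
  have side : ∀ {t : Edge d M}, (t ∈ Γ.edges ∧ x ∈ t.carrier ∧ t.carrier ⊆ e.carrier) →
      t.carrier ⊆ e₁.carrier ∨ t.carrier ⊆ e₂.carrier := by
    rintro t ⟨ht, hxt, hte⟩
    have hJ : t.inner ⊆ t.carrier \ {x} := fun p hp => ⟨hp.1, by
      rintro rfl
      exact notMem_vertices_of_mem_inner ht hp hx⟩
    have hd : (t.carrier \ {x}) ∩ (e₁.carrier ∩ e₂.carrier) = ∅ := by
      rw [hi]
      exact Set.sdiff_inter_self
    refine (isPreconnected_iff_subset_of_disjoint_closed.1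
      (t.isArc.isPreconnected_of_diff_subset hJ Set.sdiff_subset) _ _ e₁.isArc.isClosed
      e₂.isArc.isClosed (Set.sdiff_subset.trans (hu ▸ hte)) hd).imp (fun h => ?_) fun h => ?_
    · exact Edge.carrier_subset_of_inner_subset e₁.isArc.isClosed (hJ.trans h)
    · exact Edge.carrier_subset_of_inner_subset e₂.isArc.isClosed (hJ.trans h)
  have no : ∀ {t t' : Edge d M}, (t ∈ Γ.edges ∧ x ∈ t.carrier ∧ t.carrier ⊆ e.carrier) →
      (t' ∈ Γ.edges ∧ x ∈ t'.carrier ∧ t'.carrier ⊆ e.carrier) → t ≠ t' →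
      ¬ (t.carrier ⊆ e₁.carrier ∧ t'.carrier ⊆ e₁.carrier) ∧
      ¬ (t.carrier ⊆ e₂.carrier ∧ t'.carrier ⊆ e₂.carrier) := fun h h' hne =>
    ⟨fun hh => not_subset_of_common_vertex h.1 h'.1 hne.symm hx h.2.1 h'.2.1
      (Or.inr ht₁.symm) hh.1 hh.2,
    fun hh => not_subset_of_common_vertex h.1 h'.1 hne.symm hx h.2.1 h'.2.1
      (Or.inl hs₂.symm) hh.1 hh.2⟩
  have n₁₂ := no h₁ h₂ h₁₂
  have n₁₃ := no h₁ h₃ h₁₃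
  have n₂₃ := no h₂ h₃ h₂₃
  have s₁ := side h₁
  have s₂ := side h₂
  have s₃ := side h₃
  tauto

variable {G : Type*} [Group G] [TopologicalSpace G] [IsTopologicalGroup G] [CompactSpace G]
  [SecondCountableTopology G] [MeasurableSpace G] [BorelSpace G] {μ : Measure (GenConn d M G)}

omit [IsTopologicalGroup G] [CompactSpace G] [SecondCountableTopology G] [BorelSpace G] in
theorem mem_Hgr' {γ : Graph d M} {ψ : HAL μ} :
    ψ ∈ Hgr' μ γ ↔ ψ ∈ Hgr μ γ ∧
      ∀ γ' : Graph d M, γ'.support ⊂ γ.support → ∀ f ∈ Hgr μ γ', ⟪ψ, f⟫_ℂ = 0 := by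
  simp only [Hgr', Submodule.mem_inf, ← Submodule.iInf_orthogonal, Submodule.mem_iInf]
  refine and_congr_right fun _ => forall_congr' fun γ' => ?_
  by_cases h : γ'.support ⊂ γ.support
  · simp only [h, iSup_pos, forall_true_left]
    exact Submodule.mem_orthogonal' _ _
  · simp [h]

theorem IsAshtekarLewandowski.exists_inner_eq_of_sdiff [DecidableEq (Edge d M)]
    (hμ : IsAshtekarLewandowski μ) (γ : Graph d M) (R : Finset (Edge d M)) (hR : R ⊆ γ.edges)
    {f : HAL μ} (hf : f ∈ Cyl μ γ) :
    ∃ f' ∈ Cyl μ (γ.subgraph (γ.edges \ R)), ∀ β : Graph d M,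
      (∀ e ∈ β.edges, ∀ s ∈ R, e.carrier ∩ s.carrier ⊆ {s.source, s.target}) →
        ∀ ψ ∈ Hgr μ β, ⟪ψ, f⟫_ℂ = ⟪ψ, f'⟫_ℂ := by
  induction R using Finset.induction_on with
  | empty =>
    refine ⟨f, Cyl_mono_of_edges_subset (fun e he => ?_) hf, fun _ _ _ _ => rfl⟩
    simpa using he
  | insert s R hs ih =>
    rw [Finset.insert_subset_iff] at hR
    obtain ⟨f₁, hf₁, h₁⟩ := ih hR.2
    have hs' : s ∈ (γ.subgraph (γ.edges \ R)).edges := by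
      simp [hR.1, hs]
    obtain ⟨f₂, hf₂, h₂⟩ := hμ.exists_inner_eq_of_erase _ hs' hf₁
    refine ⟨f₂, Cyl_mono_of_edges_subset (fun e he => ?_) hf₂, fun β hβ ψ hψ => ?_⟩
    · simp only [Graph.mem_edges_subgraph, Finset.mem_sdiff, Finset.mem_erase,
        Finset.mem_insert] at he ⊢
      tauto
    · rw [h₁ β (fun e he r hr => hβ e he r (Finset.mem_insert_of_mem hr)) ψ hψ,
        h₂ β (fun e he => hβ e he s (Finset.mem_insert_self _ _)) ψ hψ]

/-- A state in `H'_β` is orthogonal to `H_γ` unless `β` is a subgraph of `γ` as a point set. -/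
theorem IsAshtekarLewandowski.inner_eq_zero_of_ne [T2Space M] [IsManifold (𝓡 d) ω M]
    (hμ : IsAshtekarLewandowski μ) {β γ : Graph d M}
    {ψ f : HAL μ} (hψ : ψ ∈ Hgr' μ β) (hf : f ∈ Hgr μ γ)
    (h : ∀ F ⊆ γ.edges, β.support ≠ (γ.subgraph F).support) : ⟪ψ, f⟫_ℂ = 0 := by
  classical
  obtain ⟨hψβ, hψo⟩ := mem_Hgr'.1 hψ
  suffices hker : Cyl μ γ ≤ (ℂ ∙ ψ)ᗮ by
    have := Submodule.topologicalClosure_minimal _ hker (Submodule.isClosed_orthogonal _) hf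
    rwa [Submodule.mem_orthogonal_singleton_iff_inner_right] at this
  intro f hf
  rw [Submodule.mem_orthogonal_singleton_iff_inner_right]
  -- Cut `γ` into pieces inside and outside of `β`.
  obtain ⟨V, hVf, hVγ, hV⟩ := γ.isFinitelyCut_support β
  obtain ⟨Γ, hΓs, hΓv, hΓV, hΓe, -⟩ :=
    γ.exists_subdivision G ℂ hVf.toFinset (by simpa using hVγ)
  have hinout : ∀ s ∈ Γ.edges, s.inner ⊆ β.support ∨ Disjoint s.inner β.support := by
    intro s hs
    refine hV _ s.isPreconnected_inner
      (s.inner_subset.trans ((Graph.carrier_subset_support hs).trans hΓs.subset)) ?_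
    refine Set.disjoint_left.2 fun x hx hxV => ?_
    exact Graph.notMem_vertices_of_mem_inner hs hx (hΓV (hVf.mem_toFinset.2 hxV))
  have hfΓ : f ∈ Cyl μ Γ := Cyl_le_of_support_subset hΓs.symm.subset hΓv hf
  set R := Γ.edges.filter fun s => Disjoint s.inner β.support with hR
  obtain ⟨f', hf', hff'⟩ := hμ.exists_inner_eq_of_sdiff Γ R (Finset.filter_subset _ _) hfΓ
  rw [hff' β ?_ ψ hψβ]
  swap
  · rintro e he s hs p ⟨hpe, hps⟩
    by_contra hp
    exact Set.disjoint_left.1 (Finset.mem_filter.1 hs).2 ⟨hps, hp⟩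
      (Graph.carrier_subset_support he hpe)
  set B := Γ.subgraph (Γ.edges \ R) with hB
  have hmemB : ∀ {s}, s ∈ B.edges ↔ s ∈ Γ.edges ∧ s.carrier ⊆ β.support := by
    intro s
    simp only [hB, hR, Graph.mem_edges_subgraph, Finset.mem_sdiff, Finset.mem_filter]
    constructor
    · rintro ⟨hs, -, hs'⟩
      exact ⟨hs, Edge.carrier_subset_of_inner_subset β.isClosed_support
        ((hinout s hs).resolve_right fun h => hs' ⟨hs, h⟩)⟩
    · rintro ⟨hs, hs'⟩
      refine ⟨hs, hs, fun h => ?_⟩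
      obtain ⟨p, hp⟩ := s.inner_nonempty
      exact Set.disjoint_left.1 h.2 hp (hs' hp.1)
  have hBβ : B.support ⊆ β.support := by
    intro p hp
    obtain ⟨s, hs, hps⟩ := B.mem_support.1 hp
    exact (hmemB.1 hs).2 hps
  by_cases hBeq : B.support = β.support
  swap
  · exact hψo B (hBβ.ssubset_of_ne hBeq) f' (Submodule.le_topologicalClosure _ hf')
  -- Some edge `e` of `γ` lies neither inside nor outside of `β`.
  obtain ⟨p, hpB, hpF⟩ : ∃ p ∈ B.support,
      p ∉ (γ.subgraph (γ.edges.filter fun e => e.carrier ⊆ β.support)).support := by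
    by_contra! hcon
    refine h _ (Finset.filter_subset _ _) (Set.Subset.antisymm (hBeq ▸ hcon) fun p hp => ?_)
    obtain ⟨e, he, hpe⟩ := (Graph.mem_support _).1 hp
    exact (Finset.mem_filter.1 (Graph.mem_edges_subgraph.1 he).2).2 hpe
  obtain ⟨s, hsB, hps⟩ := B.mem_support.1 hpB
  obtain ⟨e, he, hse⟩ := hΓe s (hmemB.1 hsB).1
  have heβ : ¬ e.carrier ⊆ β.support := fun heβ => hpF <| (Graph.mem_support _).2
    ⟨e, Graph.mem_edges_subgraph.2 ⟨he, Finset.mem_filter.2 ⟨he, heβ⟩⟩, hse hps⟩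
  -- Hence a piece inside and a piece outside of `β` meet in an interior point `x` of `e`.
  obtain ⟨x, hxe, hxB, hxR⟩ : (e.inner ∩ (B.support ∩ ⋃ r ∈ R, r.carrier)).Nonempty := by
    have hcov : e.inner ⊆ B.support ∪ ⋃ r ∈ R, r.carrier := by
      intro q hq
      obtain ⟨r, hr, hqr⟩ := Γ.mem_support.1 (hΓs ▸ Graph.carrier_subset_support he hq.1)
      by_cases hrR : r ∈ R
      · exact Or.inr (Set.mem_biUnion (Finset.mem_coe.2 hrR) hqr)
      · exact Or.inl (B.mem_support.2 ⟨r, Graph.mem_edges_subgraph.2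
          ⟨hr, Finset.mem_sdiff.2 ⟨hr, hrR⟩⟩, hqr⟩)
    refine isPreconnected_closed_iff.1 e.isPreconnected_inner _ _ B.isClosed_support
      (Graph.isClosed_biUnion R) hcov ?_ ?_
    · obtain ⟨q, hq⟩ := s.inner_nonempty
      refine ⟨q, ⟨hse hq.1, ?_⟩, Graph.carrier_subset_support hsB hq.1⟩
      have hqv := Graph.notMem_vertices_of_mem_inner (hmemB.1 hsB).1 hq
      rintro (rfl | rfl)
      · exact hqv (hΓv (Graph.source_mem_vertices he))
      · exact hqv (hΓv (Graph.target_mem_vertices he))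
    · by_contra hcon
      refine heβ (Edge.carrier_subset_of_inner_subset β.isClosed_support fun q hq => ?_)
      rcases hcov hq with hq' | hq'
      · exact hBβ hq'
      · exact absurd ⟨q, hq, hq'⟩ hcon
  obtain ⟨t, htB, hxt⟩ := B.mem_support.1 hxB
  simp only [Set.mem_iUnion, exists_prop] at hxR
  obtain ⟨r, hrR, hxr⟩ := hxR
  have hnotR : ∀ {t}, t ∈ B.edges → t ≠ r := by
    rintro t ht rfl
    exact (Finset.mem_sdiff.1 (Graph.mem_edges_subgraph.1 ht).2).2 hrR
  have hrΓ : r ∈ Γ.edges := (Finset.mem_filter.1 hrR).1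
  have hxv : x ∈ Γ.vertices :=
    Graph.mem_vertices_of_mem_of_mem (hmemB.1 htB).1 hrΓ (hnotR htB) hxt hxr
  have hin : ∀ {q : Edge d M}, q ∈ Γ.edges → x ∈ q.carrier →
      q ∈ Γ.edges ∧ x ∈ q.carrier ∧ q.carrier ⊆ e.carrier := by
    intro q hq hxq
    obtain ⟨e', he', hqe'⟩ := hΓe q hq
    obtain rfl := Graph.eq_of_mem_inner he hxe he' (hqe' hxq)
    exact ⟨hq, hxq, hqe'⟩
  -- So `x` has valence one in `B`, and functions on `B` do not depend on the edge at `x`.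
  have huni : ∀ q ∈ B.edges, q ≠ t → x ∉ q.carrier := fun q hq hqt hxq =>
    Graph.false_of_three_edges hxe hxv (hin (hmemB.1 hq).1 hxq) (hin (hmemB.1 htB).1 hxt)
      (hin hrΓ hxr) hqt (hnotR hq) (hnotR htB)
  have hf'' : f' ∈ Cyl μ (B.subgraph (B.edges.erase t)) := by
    refine Cyl_mono (fun u hg hu => ?_) hf'
    exact (hu.erase_of_univalent hg
      (Graph.eq_or_eq_of_mem_vertices hxv (hmemB.1 htB).1 hxt) huni).mono
      fun q hq => Graph.mem_edges_subgraph.2 ⟨Finset.mem_of_mem_erase hq, hq⟩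
  refine hψo _ ?_ f' (Submodule.le_topologicalClosure _ hf'')
  rw [← hBeq]
  refine (Graph.support_subgraph_subset _).ssubset_of_ne fun heq => ?_
  obtain ⟨q, hq⟩ := t.inner_nonempty
  have hqB : q ∈ B.support := Graph.carrier_subset_support htB hq.1
  rw [← heq] at hqB
  obtain ⟨t', ht', hqt'⟩ := (Graph.mem_support _).1 hqB
  rw [Graph.mem_edges_subgraph] at ht'
  exact Finset.ne_of_mem_erase ht'.2 (Graph.eq_of_mem_inner htB hq ht'.1 hqt')

end Orthogonality

/-! ### Diffeomorphism invariance of the Ashtekar-Lewandowski measure -/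

section Invariance

variable {d : ℕ} {M : Type*} [TopologicalSpace M] [ChartedSpace (EuclideanSpace ℝ (Fin d)) M]

/-- Finitely many edges can be decomposed into the edges of a single graph. -/
theorem Graph.exists_carrying [T2Space M] [IsManifold (𝓡 d) ω M] (F : Finset (Edge d M)) :
    ∃ Γ : Graph d M, ∀ e ∈ F, e.carrier ⊆ Γ.support ∧ e.source ∈ Γ.vertices ∧
      e.target ∈ Γ.vertices := by
  classical
  induction F using Finset.induction_on with
  | empty => exact ⟨⟨∅, by simp⟩, by simp⟩
  | insert e F _ ih =>
    obtain ⟨Γ, hΓ⟩ := ih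
    obtain ⟨W, hWf, hWe, hW⟩ := e.isFinitelyCut_support Γ
    obtain ⟨E, hEs, hEv, hEW, -, -⟩ := (single e).exists_subdivision Unit Unit hWf.toFinset
      (by simpa [support_single] using hWe)
    rw [support_single] at hEs
    obtain ⟨Γ₁, hs₁, hv₁, hV₁, -, -⟩ := Γ.exists_subdivision Unit Unit
      (E.vertices.filter (· ∈ Γ.support)) (fun x hx => (Finset.mem_filter.1 hx).2)
    have hout : ∀ {s r p}, s ∈ E.edges ∧ Disjoint s.inner Γ.support → r ∈ Γ₁.edges →
        p ∈ s.carrier → p ∈ r.carrier →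
        p ∈ ({s.source, s.target} : Set M) ∧ p ∈ ({r.source, r.target} : Set M) := by
      rintro s r p ⟨hs, hsd⟩ hr hps hpr
      have hpΓ : p ∈ Γ.support := hs₁ ▸ carrier_subset_support hr hpr
      have h : p ∈ ({s.source, s.target} : Set M) := by
        by_contra h
        exact Set.disjoint_left.1 hsd ⟨hps, h⟩ hpΓ
      have hpE : p ∈ E.vertices := E.mem_vertices.2 ⟨s, hs, h⟩
      exact ⟨h, eq_or_eq_of_mem_vertices (hV₁ (Finset.mem_filter.2 ⟨hpE, hpΓ⟩)) hr hpr⟩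
    let Γ' : Graph d M :=
      { edges := Γ₁.edges ∪ E.edges.filter fun s => Disjoint s.inner Γ.support
        disj := by
          intro a ha b hb hab
          rw [Finset.mem_union, Finset.mem_filter] at ha hb
          rcases ha with ha | ha <;> rcases hb with hb | hb
          · exact Γ₁.disj a ha b hb hab
          · exact fun p hp => (hout hb ha hp.2 hp.1).symm
          · exact fun p hp => hout ha hb hp.1 hp.2
          · exact E.disj a ha.1 b hb.1 hab }
    have hmem : ∀ {s}, s ∈ Γ'.edges ↔
        s ∈ Γ₁.edges ∨ s ∈ E.edges ∧ Disjoint s.inner Γ.support := by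
      intro s
      simp [Γ']
    have hsub : Γ.support ⊆ Γ'.support := by
      intro p hp
      rw [← hs₁] at hp
      obtain ⟨s, hs, hps⟩ := Γ₁.mem_support.1 hp
      exact carrier_subset_support (hmem.2 (Or.inl hs)) hps
    have hv' : Γ₁.vertices ⊆ Γ'.vertices := by
      intro x hx
      obtain ⟨s, hs, h⟩ := Γ₁.mem_vertices.1 hx
      exact Γ'.mem_vertices.2 ⟨s, hmem.2 (Or.inl hs), h⟩
    have hin : ∀ s ∈ E.edges, ¬ Disjoint s.inner Γ.support → s.carrier ⊆ Γ.support := by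
      intro s hs hsd
      refine Edge.carrier_subset_of_inner_subset Γ.isClosed_support
        ((hW _ s.isPreconnected_inner (s.inner_subset.trans
          ((carrier_subset_support hs).trans hEs.subset)) ?_).resolve_right hsd)
      exact Set.disjoint_left.2 fun x hx hxW =>
        notMem_vertices_of_mem_inner hs hx (hEW (hWf.mem_toFinset.2 hxW))
    have hvE : E.vertices ⊆ Γ'.vertices := by
      intro x hx
      obtain ⟨s, hs, h⟩ := E.mem_vertices.1 hx
      by_cases hsd : Disjoint s.inner Γ.support
      · exact Γ'.mem_vertices.2 ⟨s, hmem.2 (Or.inr ⟨hs, hsd⟩), h⟩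
      · refine hv' (hV₁ (Finset.mem_filter.2 ⟨hx, hin s hs hsd ?_⟩))
        rcases h with rfl | rfl
        exacts [s.isArc.source_mem, s.isArc.target_mem]
    refine ⟨Γ', fun r hr => ?_⟩
    rcases Finset.mem_insert.1 hr with rfl | hr
    · have hr : r ∈ (single r).edges := Finset.mem_singleton_self r
      refine ⟨?_, hvE (hEv (source_mem_vertices hr)), hvE (hEv (target_mem_vertices hr))⟩
      rw [← hEs]
      intro p hp
      obtain ⟨s, hs, hps⟩ := E.mem_support.1 hp
      by_cases hsd : Disjoint s.inner Γ.support
      · exact carrier_subset_support (hmem.2 (Or.inr ⟨hs, hsd⟩)) hps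
      · exact hsub (hin s hs hsd hps)
    · obtain ⟨h₁, h₂, h₃⟩ := hΓ r hr
      exact ⟨h₁.trans hsub, hv' (hv₁ h₂), hv' (hv₁ h₃)⟩

variable {G : Type*} [Group G] [TopologicalSpace G] [IsTopologicalGroup G] [CompactSpace G]
  [SecondCountableTopology G] [MeasurableSpace G] [BorelSpace G] {μ ν : Measure (GenConn d M G)}

/-- The Ashtekar-Lewandowski measure is determined by its characterization. -/
theorem IsAshtekarLewandowski.unique [T2Space M] [IsManifold (𝓡 d) ω M]
    (hμ : IsAshtekarLewandowski μ) (hν : IsAshtekarLewandowski ν) : μ = ν := by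
  have := hμ.isProbabilityMeasure
  have := hν.isProbabilityMeasure
  have hval : Measurable (GenConn.val : GenConn d M G → Edge d M → G) :=
    comap_measurable GenConn.val
  have hF : ∀ F : Finset (Edge d M), μ.map (hol F) = ν.map (hol F) := by
    intro F
    obtain ⟨Γ, hΓ⟩ := Graph.exists_carrying F
    have h : ∀ e : F, IsHolFun Γ.edges fun A : GenConn d M G => A.val e := fun e =>
      Γ.isHolFun_val_of_subset e.1 (hΓ e e.2).1 (hΓ e e.2).2.1 (hΓ e e.2).2.2
    choose K hK hKe using h
    have heq : hol (G := G) F = (fun y e => K e y) ∘ hol Γ.edges := by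
      funext A e
      exact hKe e A
    have hKm : Measurable fun (y : Γ.edges → G) (e : F) => K e y :=
      (continuous_pi hK).measurable
    rw [heq, ← Measure.map_map hKm (measurable_hol _), ← Measure.map_map hKm (measurable_hol _),
      hμ.map_hol_eq hν Γ _ subset_rfl]
  have := Measure.isProbabilityMeasure_map (μ := μ) hval.aemeasurable
  have hmap : μ.map GenConn.val = ν.map GenConn.val := by
    have hP : ∀ (ρ : Measure (GenConn d M G)) (F : Finset (Edge d M)),
        (ρ.map GenConn.val).map F.restrict = ρ.map (hol F) := fun ρ F =>
      Measure.map_map (Finset.measurable_restrict F) hval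
    have hfin : ∀ F : Finset (Edge d M), IsFiniteMeasure (μ.map (hol F)) := fun F =>
      Measure.isFiniteMeasure_map μ (hol F)
    refine IsProjectiveLimit.unique (P := fun F => μ.map (hol F)) (fun F => hP μ F)
      fun F => (hP ν F).trans (hF F).symm
  ext S hS
  obtain ⟨T, hT, rfl⟩ := hS
  rw [← Measure.map_apply hval hT, ← Measure.map_apply hval hT, hmap]

theorem Edge.map_one [IsManifold (𝓡 d) ω M] (e : Edge d M) : e.map 1 = e := by
  ext <;> simp [Edge.map]

theorem Edge.map_mul [IsManifold (𝓡 d) ω M] (φ χ : Diff d M) (e : Edge d M) :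
    e.map (φ * χ) = (e.map χ).map φ := by
  ext <;> simp [Edge.map, Set.image_image]

omit [TopologicalSpace G] [IsTopologicalGroup G] [CompactSpace G] [SecondCountableTopology G]
  [MeasurableSpace G] [BorelSpace G] in
theorem pullback_pullback [IsManifold (𝓡 d) ω M] (φ χ : Diff d M) (A : GenConn d M G) :
    pullback χ (pullback φ A) = pullback (φ * χ) A := by
  ext e
  simp [pullback, Edge.map_mul]

omit [TopologicalSpace G] [IsTopologicalGroup G] [CompactSpace G] [SecondCountableTopology G]
  [MeasurableSpace G] [BorelSpace G] in
theorem pullback_one [IsManifold (𝓡 d) ω M] (A : GenConn d M G) : pullback 1 A = A := by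
  ext e
  simp [pullback, Edge.map_one]

omit [TopologicalSpace G] [IsTopologicalGroup G] [CompactSpace G] [SecondCountableTopology G]
  [BorelSpace G] in
theorem measurable_pullback [IsManifold (𝓡 d) ω M] (φ : Diff d M) :
    Measurable (pullback (G := G) φ) := by
  refine measurable_comap_iff.2 (measurable_pi_lambda _ fun e => measurable_val (e.map φ))

theorem IsAshtekarLewandowski.map_pullback [IsManifold (𝓡 d) ω M]
    (hμ : IsAshtekarLewandowski μ) (φ : Diff d M) :
    IsAshtekarLewandowski (μ.map (pullback φ)) := by
  classical
  have := hμ.isProbabilityMeasure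
  have hφ := measurable_pullback (G := G) φ
  refine ⟨Measure.isProbabilityMeasure_map hφ.aemeasurable, fun s F hF => ?_⟩
  set F' := F.image (Edge.map φ) with hF'
  have hlaw := hμ.law (s.map φ) F' (by
    intro e he
    obtain ⟨e, he', rfl⟩ := Finset.mem_image.1 he
    simp only [Edge.map]
    rw [← Set.image_inter (φ : Equiv.Perm M).injective, ← Set.image_pair]
    exact Set.image_mono (hF e he'))
  let ρ : (F' → G) → F → G := fun y e => y ⟨e.1.map φ, Finset.mem_image_of_mem _ e.2⟩
  have hρ : Measurable ρ := measurable_pi_lambda _ fun e => measurable_pi_apply _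
  have hm : ∀ (s : Edge d M) (F : Finset (Edge d M)),
      Measurable fun A : GenConn d M G => (A.val s, hol F A) := fun s F =>
    (measurable_val s).prodMk (measurable_hol F)
  have h1 : (fun A : GenConn d M G => (A.val s, hol F A)) ∘ pullback φ =
      Prod.map id ρ ∘ fun A => (A.val (s.map φ), hol F' A) := rfl
  have h2 : hol (G := G) F ∘ pullback φ = ρ ∘ hol F' := rfl
  have := Measure.isProbabilityMeasure_map (μ := μ) (measurable_hol (G := G) F').aemeasurable
  rw [Measure.map_map (hm s F) hφ, Measure.map_map (measurable_hol F) hφ, h1, h2,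
    ← Measure.map_map (measurable_id.prodMap hρ) (hm _ _), hlaw,
    ← Measure.map_prod_map _ _ measurable_id hρ, Measure.map_id,
    Measure.map_map hρ (measurable_hol F')]

theorem IsAshtekarLewandowski.measurePreserving_pullback [T2Space M] [IsManifold (𝓡 d) ω M]
    (hμ : IsAshtekarLewandowski μ) (φ : Diff d M) : MeasurePreserving (pullback φ) μ μ :=
  ⟨measurable_pullback φ, (hμ.map_pullback φ).unique hμ⟩

end Invariance

/-! ### The action of diffeomorphisms on the Hilbert spaces of graphs -/

section Action

variable {d : ℕ} {M : Type*} [TopologicalSpace M] [T2Space M]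
  [ChartedSpace (EuclideanSpace ℝ (Fin d)) M] [IsManifold (𝓡 d) ω M]

open scoped Classical in
/-- The image of a graph under a diffeomorphism. -/
noncomputable def Graph.map (φ : Diff d M) (γ : Graph d M) : Graph d M where
  edges := γ.edges.image (Edge.map φ)
  disj := by
    intro e he e' he' hne
    obtain ⟨f, hf, rfl⟩ := Finset.mem_image.1 he
    obtain ⟨f', hf', rfl⟩ := Finset.mem_image.1 he'
    simp only [Edge.map]
    rw [← Set.image_inter (φ : Equiv.Perm M).injective, ← Set.image_pair, ← Set.image_pair,
      ← Set.image_inter (φ : Equiv.Perm M).injective]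
    exact Set.image_mono (γ.disj f hf f' hf' fun h => hne (h ▸ rfl))

omit [T2Space M] in
theorem Graph.mem_edges_map {φ : Diff d M} {γ : Graph d M} {e : Edge d M} :
    e ∈ (γ.map φ).edges ↔ ∃ e' ∈ γ.edges, e'.map φ = e := by
  classical
  simp [Graph.map]

omit [T2Space M] in
theorem Graph.support_map (φ : Diff d M) (γ : Graph d M) :
    (γ.map φ).support = φ • γ.support := by
  ext p
  rw [mem_support, Set.mem_smul_set]
  constructor
  · rintro ⟨e, he, hp⟩
    obtain ⟨f, hf, rfl⟩ := mem_edges_map.1 he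
    obtain ⟨q, hq, rfl⟩ := hp
    exact ⟨q, carrier_subset_support hf hq, rfl⟩
  · rintro ⟨q, hq, rfl⟩
    obtain ⟨e, he, hq⟩ := γ.mem_support.1 hq
    exact ⟨e.map φ, mem_edges_map.2 ⟨e, he, rfl⟩, q, hq, rfl⟩

variable {G : Type*} [Group G] [TopologicalSpace G] [IsTopologicalGroup G] [CompactSpace G]
  [SecondCountableTopology G] [MeasurableSpace G] [BorelSpace G] {μ : Measure (GenConn d M G)}

namespace IsAshtekarLewandowski

variable (hμ : IsAshtekarLewandowski μ)

include hμ

theorem unitaryDiff_eq (φ : Diff d M) :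
    unitaryDiff μ φ = (Lp.compMeasurePreservingₗᵢ ℂ (pullback φ)
      (hμ.measurePreserving_pullback φ) : HAL μ →ₗᵢ[ℂ] HAL μ).toLinearMap := by
  rw [unitaryDiff, dif_pos (hμ.measurePreserving_pullback φ)]
  rfl

theorem inner_unitaryDiff (φ : Diff d M) (f g : HAL μ) :
    ⟪unitaryDiff μ φ f, unitaryDiff μ φ g⟫_ℂ = ⟪f, g⟫_ℂ := by
  rw [hμ.unitaryDiff_eq φ]
  exact LinearIsometry.inner_map_map _ _ _

theorem continuous_unitaryDiff (φ : Diff d M) : Continuous (unitaryDiff μ φ) := by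
  rw [hμ.unitaryDiff_eq φ]
  exact LinearIsometry.continuous _

theorem coeFn_unitaryDiff (φ : Diff d M) (f : HAL μ) :
    unitaryDiff μ φ f =ᵐ[μ] f ∘ pullback φ := by
  rw [hμ.unitaryDiff_eq φ]
  exact Lp.coeFn_compMeasurePreserving f (hμ.measurePreserving_pullback φ)

theorem unitaryDiff_inv (φ : Diff d M) (f : HAL μ) :
    unitaryDiff μ φ (unitaryDiff μ φ⁻¹ f) = f := by
  have h := (hμ.measurePreserving_pullback φ).quasiMeasurePreserving.ae_eq_comp
    (hμ.coeFn_unitaryDiff φ⁻¹ f)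
  refine Lp.ext ((hμ.coeFn_unitaryDiff φ _).trans (h.trans (Filter.Eventually.of_forall fun A => ?_)))
  simp only [Function.comp_apply, pullback_pullback, mul_inv_cancel, pullback_one]

theorem unitaryDiff_mem_Hgr (φ : Diff d M) {γ : Graph d M} {f : HAL μ} (hf : f ∈ Hgr μ γ) :
    unitaryDiff μ φ f ∈ Hgr μ (γ.map φ) := by
  refine map_mem_closure (hμ.continuous_unitaryDiff φ) hf fun ψ hψ => ?_
  obtain ⟨u, ⟨F, hF, hu⟩, hg, hψu⟩ := mem_Cyl.1 hψ
  refine mem_Cyl.2 ⟨u ∘ pullback φ, ⟨fun y => F fun e =>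
    y ⟨e.1.map φ, Graph.mem_edges_map.2 ⟨e, e.2, rfl⟩⟩, ?_, fun A => hu _⟩, fun g A => ?_, ?_⟩
  · exact hF.comp (continuous_pi fun e => continuous_apply _)
  · exact hg (g ∘ (φ : Equiv.Perm M)) (pullback φ A)
  · exact (hμ.coeFn_unitaryDiff φ ψ).trans
      ((hμ.measurePreserving_pullback φ).quasiMeasurePreserving.ae_eq_comp hψu)

theorem unitaryDiff_mem_Hgr' (φ : Diff d M) {γ : Graph d M} {f : HAL μ} (hf : f ∈ Hgr' μ γ) :
    unitaryDiff μ φ f ∈ Hgr' μ (γ.map φ) := by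
  rw [mem_Hgr'] at hf ⊢
  refine ⟨hμ.unitaryDiff_mem_Hgr φ hf.1, fun γ' hγ' h hh => ?_⟩
  rw [← hμ.unitaryDiff_inv φ h, hμ.inner_unitaryDiff]
  refine hf.2 (γ'.map φ⁻¹) ?_ _ (hμ.unitaryDiff_mem_Hgr φ⁻¹ hh)
  rw [Graph.support_map] at hγ' ⊢
  exact ⟨Set.subset_smul_set_iff.1 hγ'.1,
    fun h => hγ'.2 (Set.smul_set_subset_iff_subset_inv_smul_set.2 h)⟩

end IsAshtekarLewandowski

end Action

/-! ### The kinematical state of a diffeomorphism-invariant state -/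

namespace DiffInvState

variable {d : ℕ} {M : Type*} [TopologicalSpace M] [T2Space M]
  [ChartedSpace (EuclideanSpace ℝ (Fin d)) M] [IsManifold (𝓡 d) ω M]
  {G : Type*} [Group G] [TopologicalSpace G] [IsTopologicalGroup G] [CompactSpace G]
  [SecondCountableTopology G] [MeasurableSpace G] [BorelSpace G] {μ : Measure (GenConn d M G)}
  (hμ : IsAshtekarLewandowski μ) (Ψ : DiffInvState μ)

omit [T2Space M] [IsTopologicalGroup G] [CompactSpace G] [SecondCountableTopology G]
  [BorelSpace G] in
theorem image_eq (p : Ψ.Index) : Ψ.image p = ((p.1 : Graph d M).map p.2.out).support :=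
  (Graph.support_map _ _).symm

omit [T2Space M] [IsTopologicalGroup G] [CompactSpace G] [SecondCountableTopology G]
  [BorelSpace G] in
/-- Only finitely many of the summands of `Ψ` live on a given graph: the class of `φ` is determined
by `γ` and `φ(γ)`. -/
theorem finite_image_eq (α : Graph d M) : {p : Ψ.Index | Ψ.image p = α.support}.Finite := by
  refine Set.Finite.of_injOn (f := fun p : Ψ.Index => (p.1 : Graph d M))
    (t := {γ ∈ Ψ.S | ∃ φ : Diff d M, φ • γ.support = α.support})
    (fun p hp => ⟨p.1.2, p.2.out, hp⟩) ?_ (Ψ.locallyFinite α)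
  rintro ⟨γ, q⟩ hq ⟨γ', q'⟩ hq' h
  obtain rfl : γ = γ' := Subtype.ext h
  have hst : q.out • (γ : Graph d M).support = q'.out • (γ : Graph d M).support :=
    Eq.trans hq (Eq.symm hq')
  have : (q.out : Diff d M ⧸ (γ : Graph d M).stab) = q'.out := by
    rw [QuotientGroup.eq]
    change (q.out⁻¹ * q'.out) • (γ : Graph d M).support = (γ : Graph d M).support
    rw [mul_smul, ← hst, inv_smul_smul]
  rw [QuotientGroup.out_eq', QuotientGroup.out_eq'] at this
  rw [this]

include hμ

theorem term_mem_Hgr' (p : Ψ.Index) :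
    Ψ.term p ∈ Hgr' μ ((p.1 : Graph d M).map p.2.out) :=
  hμ.unitaryDiff_mem_Hgr' _ (Ψ.comp_mem _ p.1.2)

theorem term_mem_Hgr {p : Ψ.Index} {α : Graph d M} (h : Ψ.image p = α.support) :
    Ψ.term p ∈ Hgr μ α :=
  Hgr_mono (Cyl_le_of_support_eq ((Ψ.image_eq p).symm.trans h)) (Ψ.term_mem_Hgr' hμ p).1

theorem component_mem_Hgr (α : Graph d M) : Ψ.component α ∈ Hgr μ α :=
  finsum_mem_induction (· ∈ Hgr μ α) (zero_mem _) (fun _ _ hx hy => add_mem hx hy)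
    fun _ hp => Ψ.term_mem_Hgr hμ hp

theorem kin_mem_Hgr (γ₀ : Graph d M) : Ψ.kin γ₀ ∈ Hgr μ γ₀ :=
  sum_mem fun F _ => Hgr_mono (Cyl_mono_of_edges_subset fun _ he =>
    (Graph.mem_edges_subgraph.1 he).1) (Ψ.component_mem_Hgr hμ (γ₀.subgraph F))

theorem exists_image_eq_of_inner_ne_zero {γ₀ : Graph d M} {f : HAL μ} (hf : f ∈ Hgr μ γ₀)
    {p : Ψ.Index} (hp : ⟪Ψ.term p, f⟫_ℂ ≠ 0) :
    ∃ F ∈ γ₀.edges.powerset, Ψ.image p = (γ₀.subgraph F).support := by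
  by_contra! h
  refine hp (hμ.inner_eq_zero_of_ne (Ψ.term_mem_Hgr' hμ p) hf fun F hF => ?_)
  rw [← Ψ.image_eq]
  exact h F (Finset.mem_powerset.2 hF)

theorem finite_inner_ne_zero {γ₀ : Graph d M} {f : HAL μ} (hf : f ∈ Hgr μ γ₀) :
    {p : Ψ.Index | ⟪Ψ.term p, f⟫_ℂ ≠ 0}.Finite := by
  refine (γ₀.edges.powerset.finite_toSet.biUnion fun F _ =>
    Ψ.finite_image_eq (γ₀.subgraph F)).subset fun p hp => ?_
  obtain ⟨F, hF, h⟩ := Ψ.exists_image_eq_of_inner_ne_zero hμ hf hp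
  exact Set.mem_biUnion (Finset.mem_coe.2 hF) h

/-- On `H_γ₀`, the functional `(Ψ|` is represented by the kinematical state `Ψ̃`. -/
theorem pairing_eq_inner_kin {γ₀ : Graph d M} {f : HAL μ} (hf : f ∈ Hgr μ γ₀) :
    Ψ.pairing f = ⟪Ψ.kin γ₀, f⟫_ℂ := by
  classical
  let T : Finset (Edge d M) → Finset Ψ.Index := fun F =>
    (Ψ.finite_image_eq (γ₀.subgraph F)).toFinset
  have hT : ∀ {F p}, p ∈ T F ↔ Ψ.image p = (γ₀.subgraph F).support := fun {F p} =>
    (Ψ.finite_image_eq (γ₀.subgraph F)).mem_toFinset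
  have hcomp : ∀ F, Ψ.component (γ₀.subgraph F) = ∑ p ∈ T F, Ψ.term p := fun F =>
    finsum_mem_eq_finite_toFinset_sum _ (Ψ.finite_image_eq (γ₀.subgraph F))
  have hdisj : ((γ₀.edges.powerset : Finset _) : Set (Finset (Edge d M))).PairwiseDisjoint T := by
    intro F hF F' hF' hne
    refine Finset.disjoint_left.2 fun p hp hp' => hne ?_
    have h := (hT.1 hp).symm.trans (hT.1 hp')
    exact Finset.Subset.antisymm
      (Graph.edges_subset_of_support_subgraph_eq (Finset.mem_powerset.1 (Finset.mem_coe.1 hF)) h)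
      (Graph.edges_subset_of_support_subgraph_eq (Finset.mem_powerset.1 (Finset.mem_coe.1 hF'))
        h.symm)
  rw [kin, sum_inner]
  simp only [hcomp, sum_inner]
  rw [← Finset.sum_biUnion hdisj]
  refine finsum_eq_sum_of_support_subset _ fun p hp => ?_
  obtain ⟨F, hF, h⟩ := Ψ.exists_image_eq_of_inner_ne_zero hμ hf hp
  exact Finset.mem_coe.2 (Finset.mem_biUnion.2 ⟨F, hF, hT.2 h⟩)

end DiffInvState

/-! ### Quadratic forms of unbounded operators -/

section Operators

variable {E : Type*} [NormedAddCommGroup E] [InnerProductSpace ℂ E]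

theorem hasExpectation_add {A B : E →ₗ.[ℂ] E} {x : E} {z : ℂ} :
    HasExpectation (A + B) x z ↔
      ∃ a b, HasExpectation A x a ∧ HasExpectation B x b ∧ z = a + b := by
  constructor
  · rintro ⟨h, rfl⟩
    have h' := h
    rw [LinearPMap.add_domain, Submodule.mem_inf] at h'
    refine ⟨_, _, ⟨h'.1, rfl⟩, ⟨h'.2, rfl⟩, ?_⟩
    rw [LinearPMap.add_apply, inner_add_right]
  · rintro ⟨_, _, ⟨h₁, rfl⟩, ⟨h₂, rfl⟩, rfl⟩
    refine ⟨Submodule.mem_inf.2 ⟨h₁, h₂⟩, ?_⟩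
    rw [LinearPMap.add_apply, inner_add_right]

theorem hasExpectation_sum {ι : Type*} {s : Finset ι} {A : ι → E →ₗ.[ℂ] E} {x : E} {z : ℂ} :
    HasExpectation (∑ i ∈ s, A i) x z ↔
      ∃ w : ι → ℂ, (∀ i ∈ s, HasExpectation (A i) x (w i)) ∧ z = ∑ i ∈ s, w i := by
  classical
  induction s using Finset.induction_on generalizing z with
  | empty =>
    simp only [Finset.sum_empty, Finset.notMem_empty, false_imp_iff, implies_true, true_and,
      exists_const]
    constructor
    · rintro ⟨h, rfl⟩
      exact inner_zero_right _
    · rintro rfl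
      exact ⟨Submodule.mem_top, inner_zero_right _⟩
  | insert i s hi ih =>
    rw [Finset.sum_insert hi, hasExpectation_add]
    constructor
    · rintro ⟨a, b, ha, hb, rfl⟩
      obtain ⟨w, hw, rfl⟩ := ih.1 hb
      refine ⟨Function.update w i a, fun j hj => ?_, ?_⟩
      · by_cases hji : j = i
        · subst hji
          simpa using ha
        · simpa [hji] using hw j ((Finset.mem_insert.1 hj).resolve_left hji)
      · rw [Finset.sum_insert hi, Function.update_self]
        congr 1
        exact Finset.sum_congr rfl fun j hj =>
          (Function.update_of_ne (by rintro rfl; exact hi hj) _ _).symm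
    · rintro ⟨w, hw, rfl⟩
      exact ⟨w i, _, hw i (Finset.mem_insert_self _ _),
        ih.2 ⟨w, fun j hj => hw j (Finset.mem_insert_of_mem hj), rfl⟩, Finset.sum_insert hi⟩

/-- `P T P` is densely defined if `T` is densely defined on the range of `P`. -/
theorem dense_compress_domain (K : Submodule ℂ E) [K.HasOrthogonalProjection] (T : E →ₗ.[ℂ] E)
    (h : K ≤ (T.domain ⊓ K).topologicalClosure) :
    Dense ((compress K T).domain : Set E) := by
  intro x
  have hx : K.starProjection x + (x - K.starProjection x) = x := by abel
  rw [← hx]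
  refine map_mem_closure (f := fun y => y + (x - K.starProjection x)) (by fun_prop)
    (h (K.starProjection_apply_mem x)) fun y hy => ?_
  change K.starProjection (y + (x - K.starProjection x)) ∈ T.domain
  have h0 : K.starProjection (x - K.starProjection x) = 0 :=
    (Submodule.starProjection_apply_eq_zero_iff K).2 (K.sub_starProjection_mem_orthogonal x)
  rw [map_add, h0, add_zero, Submodule.starProjection_eq_self_iff.2 hy.2]
  exact hy.1

theorem inner_compress_eq_zero_iff (K : Submodule ℂ E) [K.HasOrthogonalProjection]
    (T : E →ₗ.[ℂ] E) {x : E} (hx : x ∈ K) :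
    (∀ y, ⟪x, compress K T y⟫_ℂ = 0) ↔ ∀ f : T.domain, (f : E) ∈ K → ⟪x, T f⟫_ℂ = 0 := by
  have key : ∀ y : E, ⟪x, K.starProjection y⟫_ℂ = ⟪x, y⟫_ℂ := fun y => by
    rw [← Submodule.inner_starProjection_left_eq_right, Submodule.starProjection_eq_self_iff.2 hx]
  constructor
  · intro h f hf
    have hPf : K.starProjection (f : E) = f := Submodule.starProjection_eq_self_iff.2 hf
    have hmem : (f : E) ∈ (compress K T).domain := by
      change K.starProjection (f : E) ∈ T.domain
      rw [hPf]
      exact f.2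
    have h1 : compress K T ⟨f, hmem⟩ = K.starProjection (T f) := by
      change K.starProjection (T ⟨K.starProjection (f : E), _⟩) = _
      congr 2
      exact Subtype.ext hPf
    rw [← key, ← h1]
    exact h _
  · intro h y
    exact (key _).trans (h ⟨_, y.2⟩ (K.starProjection_apply_mem _))

variable [CompleteSpace E] {T : E →ₗ.[ℂ] E}

/-- The quadratic form of `T T†` is the squared norm of `T†`. -/
theorem HasExpectation.exists_norm_sq (hT : Dense (T.domain : Set E)) {x : E} {z : ℂ}
    (h : HasExpectation (mulAdjoint T) x z) :
    ∃ hx : x ∈ T.adjoint.domain, z = ((‖T.adjoint ⟨x, hx⟩‖ ^ 2 : ℝ) : ℂ) := by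
  obtain ⟨⟨hx, hx'⟩, rfl⟩ := h
  refine ⟨hx, ?_⟩
  have := T.adjoint_isFormalAdjoint hT ⟨x, hx⟩ ⟨_, hx'⟩
  refine (this.symm).trans ?_
  simp [inner_self_eq_norm_sq_to_K]

theorem hasExpectation_mulAdjoint_zero (hT : Dense (T.domain : Set E)) {x : E} :
    HasExpectation (mulAdjoint T) x 0 ↔ ∀ y, ⟪x, T y⟫_ℂ = 0 := by
  constructor
  · intro h y
    obtain ⟨hx, h0⟩ := h.exists_norm_sq hT
    have h0 : T.adjoint ⟨x, hx⟩ = 0 := by simpa using h0.symm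
    have := T.adjoint_isFormalAdjoint hT ⟨x, hx⟩ y
    rw [h0, inner_zero_left] at this
    exact this.symm
  · intro h
    have hx : x ∈ T.adjoint.domain :=
      T.mem_adjoint_domain_of_exists x ⟨0, fun y => by rw [h, inner_zero_left]⟩
    have h0 : T.adjoint ⟨x, hx⟩ = 0 :=
      LinearPMap.adjoint_apply_eq hT _ fun y => by rw [h, inner_zero_left]
    have hx' : T.adjoint ⟨x, hx⟩ ∈ T.domain := h0 ▸ zero_mem _
    exact ⟨⟨hx, hx'⟩, h _⟩

/-- The expectation value of `∑ Tᵢ Tᵢ†` vanishes if and only if all `Tᵢ†` do. -/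
theorem hasExpectation_sum_mulAdjoint_zero {ι : Type*} {s : Finset ι} {T : ι → E →ₗ.[ℂ] E}
    (hT : ∀ i ∈ s, Dense ((T i).domain : Set E)) {x : E} :
    HasExpectation (∑ i ∈ s, mulAdjoint (T i)) x 0 ↔ ∀ i ∈ s, ∀ y, ⟪x, T i y⟫_ℂ = 0 := by
  rw [hasExpectation_sum]
  constructor
  · rintro ⟨w, hw, h0⟩ i hi
    rw [← hasExpectation_mulAdjoint_zero (hT i hi)]
    have hre : ∀ j ∈ s, 0 ≤ (w j).re ∧ w j = ((w j).re : ℂ) := fun j hj => by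
      obtain ⟨hx, h⟩ := (hw j hj).exists_norm_sq (hT j hj)
      rw [h, Complex.ofReal_re]
      exact ⟨sq_nonneg _, rfl⟩
    have hsum : ∑ j ∈ s, (w j).re = 0 := by
      rw [← Complex.re_sum, ← h0, Complex.zero_re]
    have hwi : w i = 0 := by
      rw [(hre i hi).2, (Finset.sum_eq_zero_iff_of_nonneg fun j hj => (hre j hj).1).1 hsum i hi,
        Complex.ofReal_zero]
    exact hwi ▸ hw i hi
  · intro h
    exact ⟨fun _ => 0, fun i hi => (hasExpectation_mulAdjoint_zero (hT i hi)).2 (h i hi), by simp⟩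

end Operators

end LQG

theorem proposition1 {d : ℕ} {M : Type*} [TopologicalSpace M] [T2Space M]
    [ChartedSpace (EuclideanSpace ℝ (Fin d)) M] [IsManifold (𝓡 d) ω M]
    {G : Type*} [Group G] [TopologicalSpace G] [IsTopologicalGroup G] [CompactSpace G] [T2Space G]
    [SecondCountableTopology G] [MeasurableSpace G] [BorelSpace G]
    (μ : Measure (LQG.GenConn d M G)) (hμ : LQG.IsAshtekarLewandowski μ)
    (γ₀ : LQG.Graph d M)
    (H : LQG.ConstraintFamily μ) (hpres : H.GraphPreserving)
    (hdense : H.DenselyDefinedOn γ₀) (hsum : H.IsVertexSumOn γ₀)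
    (Ψ : LQG.DiffInvState μ) :
    (∀ f ∈ LQG.Hgr μ γ₀, {p : Ψ.Index | ⟪Ψ.term p, f⟫_ℂ ≠ 0}.Finite) ∧
    Ψ.kin γ₀ ∈ LQG.Hgr μ γ₀ ∧
    ((∀ (N : M → ℝ) (f : H.dom), (f : LQG.HAL μ) ∈ LQG.Hgr μ γ₀ → Ψ.pairing (H.op N f) = 0) ↔
      LQG.HasExpectation (H.quadratic γ₀) (Ψ.kin γ₀) 0) := by
  have hkin := Ψ.kin_mem_Hgr hμ γ₀
  refine ⟨fun f hf => Ψ.finite_inner_ne_zero hμ hf, hkin, ?_⟩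
  have hd : ∀ v ∈ γ₀.vertices, Dense ((H.restrictedOp γ₀ v).domain : Set (LQG.HAL μ)) :=
    fun v _ => LQG.dense_compress_domain _ _ hdense
  rw [LQG.ConstraintFamily.quadratic, LQG.hasExpectation_sum_mulAdjoint_zero hd]
  have hpair : ∀ (N : M → ℝ) (f : H.dom), (f : LQG.HAL μ) ∈ LQG.Hgr μ γ₀ →
      Ψ.pairing (H.op N f) = ⟪Ψ.kin γ₀, H.op N f⟫_ℂ := fun N f hf =>
    Ψ.pairing_eq_inner_kin hμ (hpres γ₀ N f hf)
  constructor
  · intro h v _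
    refine (LQG.inner_compress_eq_zero_iff _ _ hkin).2 fun f hf => ?_
    exact (hpair _ f hf).symm.trans (h _ f hf)
  · intro h N f hf
    rw [hpair N f hf, hsum N f hf, inner_sum]
    refine Finset.sum_eq_zero fun v hv => ?_
    rw [inner_smul_right, (LQG.inner_compress_eq_zero_iff _ _ hkin).1 (h v hv) f hf, mul_zero]
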